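/- Let $E$ be a finite-dimensional real vector space with a Lebesgue (Haar) measure $\mu$ (for example $E=\mathbb{R}^N$, $N\ge 0$) and let $n\in\mathbb{N}_0$. Let $\mathcal{D}$ be the space of real-valued test functions (smooth, compactly supported) on $E$, let $\mathcal{D}_n^{\vee\prime}$ be the space of totally symmetric distributions on $E^n$, and let $\mathcal{E}_n^{\vee}$ be the space of totally symmetric real-valued smooth functions on $E^n$, with their standard topologies. For $f\in\mathcal{D}$ let $C_f g=f\star g$ be the convolution operator, let $\otimes^n C_f$ be its application in each of the $n$ variables (that is, the convolution by $f\otimes\cdots\otimes f$), and put $f^t(x)=f(-x)$. Let $$W_n^{\vee}=\bigl\{\,w:\mathcal{D}\setminus\{0\}\to\mathcal{E}_n^{\vee}\ \bigm|\ w(f)=\otimes^n C_h\,w(g)\ \text{ whenever } f,g,h\in\mathcal{D}\setminus\{0\},\ f=C_h g\,\bigr\},$$ with the topology of a subspace of the product $\prod_{f\in\mathcal{D}\setminus\{0\}}\mathcal{E}_n^{\vee}$. For $w\in W_n^\vee$ put $\Pi_f w=w(f)$ if $f\neq 0$ and $\Pi_0w=0$, and for $f_1,\dots,f_n\in\mathcal{D}$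 put $$\Pi^{\vee}_{f_1,\dots,f_n}w=\frac1{n!}\sum_{\epsilon\in\{0,1\}^n}(-1)^{n-(\epsilon_1+\cdots+\epsilon_n)}\,\Pi_{\epsilon_1f_1+\cdots+\epsilon_nf_n}w,\qquad \widetilde w(f_1,\dots,f_n)=\bigl(\Pi^{\vee}_{f_1^t,\dots,f_n^t}w\bigr)(0).$$ **Theorem.** The formula $j(\omega)(f)=\otimes^n C_f\,\omega$ defines a continuous linear bijection $j:\mathcal{D}_n^{\vee\prime}\to W_n^{\vee}$; that is, every symmetric Wilsonian flow of $n$-point functions is $f\mapsto\otimes^nC_f\,\omega$ for a unique totally symmetric distribution $\omega$. If $n\ge 1$, then for every $w\in W_n^\vee$ there is a unique $k(w)\in\mathcal{D}_n^{\vee\prime}$ with $(k(w)\,|\,f_1\otimes\cdots\otimes f_n)=\widetilde w(f_1,\dots,f_n)$ for all $f_1,\dots,f_n\in\mathcal{D}$, the map $k:W_n^\vee\to\mathcal{D}_n^{\vee\prime}$ is linear, and $k$ is the two-sided inverse of $j$: $k\circ j=\mathrm{id}$ and $j\circ k=\mathrm{id}$. -/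

import Mathlib

open MeasureTheory TopologicalSpace
open scoped Distributions Convolution

noncomputable section

namespace Wilson

/-- Real valued test functions (smooth, compactly supported) on `V`, with Mathlib's canonical
LF topology. -/
abbrev Test (V : Type*) [NormedAddCommGroup V] [NormedSpace ℝ V] : Type _ :=
  𝓓((⊤ : Opens V), ℝ)

section TestFunctions

variable {V : Type*} [NormedAddCommGroup V] [NormedSpace ℝ V]

/-- The test function `y ↦ F (x - y)`. -/
def shiftReflect (F : Test V) (x : V) : Test V where
  toFun y := F (x - y)
  contDiff' := F.contDiff.comp (contDiff_const.sub contDiff_id)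
  hasCompactSupport' := F.hasCompactSupport.comp_homeomorph (Homeomorph.subLeft x)
  tsupport_subset' := fun _ _ => trivial

/-- The reflected test function `Fᵗ : y ↦ F (-y)`. -/
def reflect (F : Test V) : Test V where
  toFun y := F (-y)
  contDiff' := F.contDiff.comp contDiff_neg
  hasCompactSupport' := F.hasCompactSupport.comp_homeomorph (Homeomorph.neg V)
  tsupport_subset' := fun _ _ => trivial

end TestFunctions

variable (E : Type*) [NormedAddCommGroup E] [NormedSpace ℝ E]

section Tensor

variable {E} {n : ℕ}

/-- Permutation of the variables of an `n`-variate test function. -/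
def permute (σ : Equiv.Perm (Fin n)) (F : Test (Fin n → E)) : Test (Fin n → E) where
  toFun x := F (fun i => x (σ i))
  contDiff' := F.contDiff.comp (contDiff_pi.2 fun i => contDiff_apply ℝ E (σ i))
  hasCompactSupport' := F.hasCompactSupport.comp_homeomorph
    { toFun := fun x i => x (σ i)
      invFun := fun x i => x (σ.symm i)
      left_inv := fun x => by simp
      right_inv := fun x => by simp
      continuous_toFun := by fun_prop
      continuous_invFun := by fun_prop }
  tsupport_subset' := fun _ _ => trivial

/-- The tensor product `f₁ ⊗ ⋯ ⊗ fₙ`, that is `(x₁, …, xₙ) ↦ f₁(x₁) ⋯ fₙ(xₙ)`. -/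
def tensor (f : Fin n → Test E) : Test (Fin n → E) where
  toFun x := ∏ i, f i (x i)
  contDiff' := contDiff_prod fun i _ => (f i).contDiff.comp (contDiff_apply ℝ E i)
  hasCompactSupport' := by
    refine HasCompactSupport.intro
      (isCompact_univ_pi fun i => (f i).hasCompactSupport.isCompact) fun x hx => ?_
    simp only [Set.mem_univ_pi, not_forall] at hx
    obtain ⟨i, hi⟩ := hx
    exact Finset.prod_eq_zero (Finset.mem_univ i) (image_eq_zero_of_notMem_tsupport hi)
  tsupport_subset' := fun _ _ => trivial

end Tensor

/-- The totally symmetric smooth functions of `n` variables in `E`, as a space of functions. -/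
def symSmoothSubmodule (n : ℕ) : Submodule ℝ ((Fin n → E) → ℝ) where
  carrier := {φ | ContDiff ℝ (⊤ : ℕ∞) φ ∧
    ∀ (σ : Equiv.Perm (Fin n)) (x : Fin n → E), φ (fun i => x (σ i)) = φ x}
  zero_mem' := ⟨contDiff_const, fun _ _ => rfl⟩
  add_mem' := fun {φ ψ} hφ hψ => ⟨hφ.1.add hψ.1, fun σ x => by
    simp only [Pi.add_apply, hφ.2 σ x, hψ.2 σ x]⟩
  smul_mem' := fun c φ hφ => ⟨contDiff_const.smul hφ.1, fun σ x => by
    simp only [Pi.smul_apply, hφ.2 σ x]⟩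

/-- The space of totally symmetric smooth functions of `n` variables in `E`. It is a separate type
so that it does not carry the topology of pointwise convergence. -/
def SymSmooth (n : ℕ) : Type _ := symSmoothSubmodule E n

instance (n : ℕ) : AddCommGroup (SymSmooth E n) :=
  inferInstanceAs (AddCommGroup (symSmoothSubmodule E n))

instance (n : ℕ) : Module ℝ (SymSmooth E n) :=
  inferInstanceAs (Module ℝ (symSmoothSubmodule E n))

instance (n : ℕ) : CoeFun (SymSmooth E n) (fun _ => (Fin n → E) → ℝ) :=
  ⟨fun φ => φ.1⟩

/-- The `m`-th derivative of a smooth function, as a continuous function. -/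
def SymSmooth.derivative {n : ℕ} (m : ℕ) (φ : SymSmooth E n) :
    C(Fin n → E, (Fin n → E) [×m]→L[ℝ] ℝ) where
  toFun := iteratedFDeriv ℝ m φ.1
  continuous_toFun := φ.2.1.continuous_iteratedFDeriv (by exact_mod_cast le_top)

/-- The smooth function topology: uniform convergence of all derivatives on compact sets. -/
instance (n : ℕ) : TopologicalSpace (SymSmooth E n) :=
  ⨅ m : ℕ, TopologicalSpace.induced (SymSmooth.derivative E m) inferInstance

/-- The totally symmetric distributions of `n` variables in `E`. The topology is the one of
Mathlib's `Distribution`, uniform convergence on compact sets of test functions; it agrees with the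
strong dual topology because the space of test functions is a Montel space. -/
def SymDist (n : ℕ) : Submodule ℝ 𝓓'((⊤ : Opens (Fin n → E)), ℝ) where
  carrier := {ω | ∀ (σ : Equiv.Perm (Fin n)) (F : Test (Fin n → E)), ω (permute σ F) = ω F}
  zero_mem' := fun _ _ => rfl
  add_mem' := fun {ω η} hω hη σ F => by
    change ω _ + η _ = ω _ + η _
    rw [hω σ F, hη σ F]
  smul_mem' := fun c ω hω σ F => by
    change c • ω _ = c • ω _
    rw [hω σ F]

section Convolution

variable {E} {n : ℕ}

/-- `⊗ⁿ C_f ω` for a distribution `ω`, that is the convolution of `f ⊗ ⋯ ⊗ f` and `ω`. -/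
def tensorConvDist (f : Test E) (ω : 𝓓'((⊤ : Opens (Fin n → E)), ℝ)) (x : Fin n → E) : ℝ :=
  ω (shiftReflect (tensor fun _ => f) x)

variable [MeasurableSpace E] (μ : Measure E)

/-- `C_h g = h ⋆ g` for functions on `E`. -/
def conv (h : Test E) (g : E → ℝ) : E → ℝ :=
  h ⋆[ContinuousLinearMap.mul ℝ ℝ, μ] g

/-- `⊗ⁿ C_h φ` for functions of `n` variables: the convolution by `h` in each variable, that is
the convolution by `h ⊗ ⋯ ⊗ h`. -/
def tensorConv (h : Test E) (φ : (Fin n → E) → ℝ) : (Fin n → E) → ℝ :=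
  (tensor fun _ => h) ⋆[ContinuousLinearMap.mul ℝ ℝ, Measure.pi fun _ => μ] φ

lemma tensorConv_apply (h : Test E) (φ : (Fin n → E) → ℝ) (x : Fin n → E) :
    tensorConv μ h φ x = ∫ y, (∏ i, h (y i)) * φ (x - y) ∂Measure.pi fun _ => μ := rfl

lemma tensorConv_add [BorelSpace E] [FiniteDimensional ℝ E] [μ.IsAddHaarMeasure]
    (h : Test E) {φ ψ : (Fin n → E) → ℝ} (hφ : Continuous φ) (hψ : Continuous ψ) :
    tensorConv μ h (φ + ψ) = tensorConv μ h φ + tensorConv μ h ψ := by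
  have key : ∀ χ : (Fin n → E) → ℝ, Continuous χ →
      ConvolutionExists (tensor fun _ : Fin n => h) χ (ContinuousLinearMap.mul ℝ ℝ)
        (Measure.pi fun _ => μ) := fun χ hχ =>
    (tensor fun _ => h).hasCompactSupport.convolutionExists_left _
      (tensor fun _ => h).continuous hχ.locallyIntegrable
  exact (key φ hφ).distrib_add (key ψ hψ)

lemma tensorConv_smul (h : Test E) (c : ℝ) (φ : (Fin n → E) → ℝ) :
    tensorConv μ h (c • φ) = c • tensorConv μ h φ :=
  convolution_smul

end Convolution

section Flows

variable [FiniteDimensional ℝ E] [MeasurableSpace E] [BorelSpace E]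

/-- The space of `n`-variate symmetric Wilsonian generalized functions: the families `w(f)` of
totally symmetric smooth functions, indexed by the nonzero test functions `f`, such that
`w(f) = ⊗ⁿ C_h w(g)` whenever `f = C_h g`. Its topology is the projective limit topology, that is
the subspace topology of the product. -/
def SymFlow (μ : Measure E) [μ.IsAddHaarMeasure] (n : ℕ) :
    Submodule ℝ ({f : Test E // f ≠ 0} → SymSmooth E n) where
  carrier := {w | ∀ f g h : {f : Test E // f ≠ 0}, (f.1 : E → ℝ) = conv μ h.1 g.1 →
    (w f : (Fin n → E) → ℝ) = tensorConv μ h.1 (w g)}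
  zero_mem' := fun f g h _ => by
    change (0 : (Fin n → E) → ℝ) = tensorConv μ h.1 (0 : (Fin n → E) → ℝ)
    exact convolution_zero.symm
  add_mem' := fun {w v} hw hv f g h hf => by
    change (w f).1 + (v f).1 = tensorConv μ h.1 ((w g).1 + (v g).1)
    rw [tensorConv_add μ h.1 (w g).2.1.continuous (v g).2.1.continuous, hw f g h hf, hv f g h hf]
  smul_mem' := fun c w hw f g h hf => by
    change c • (w f).1 = tensorConv μ h.1 (c • (w g).1)
    rw [tensorConv_smul, hw f g h hf]

variable {E} {μ : Measure E} [μ.IsAddHaarMeasure] {n : ℕ}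

open Classical in
/-- The canonical projection `Π_f w = w(f)`, extended by `0` to `f = 0`. -/
def proj (f : Test E) (w : SymFlow E μ n) : SymSmooth E n :=
  if hf : f = 0 then 0 else w.1 ⟨f, hf⟩

/-- The polarized projection
`(1/n!) ∑_ε (-1)^(n - (ε₁ + ⋯ + εₙ)) Π_(ε₁ f₁ + ⋯ + εₙ fₙ) w` over `ε ∈ {0,1}ⁿ`, where `ε` is
given by the set `S` of the indices `i` with `εᵢ = 1`. -/
def polarProj (f : Fin n → Test E) (w : SymFlow E μ n) : SymSmooth E n :=
  (1 / (n.factorial : ℝ)) • ∑ S : Finset (Fin n), (-1 : ℝ) ^ (n - S.card) • proj (∑ i ∈ S, f i) w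

/-- The map `w̃(f₁, …, fₙ) = (Π^∨_(f₁ᵗ, …, fₙᵗ) w)(0)`. -/
def tilde (w : SymFlow E μ n) (f : Fin n → Test E) : ℝ :=
  polarProj (fun i => reflect (f i)) w 0

end Flows

end Wilson

end

/-! Write `τ_x F` for the translate of `F`. A distribution on test functions supported in a compact
set factors through finitely many derivatives in sup norm (`exists_local_representation`). Hence `x
↦ ω (τ_x F)` is smooth, and `ω` commutes with superpositions of translates
(`apply_eq_integral_translate`). This makes `j` well defined and gives the flow equation.

Injectivity: at `x = 0` the flow of `ω` at `f` is `ω` on the tensor power of `fᵗ`. Polarization by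
Ryser's formula recovers all tensor products, and these determine `ω` by mollification.

Surjectivity: for a mollifier `h k`, commutativity gives `⊗ⁿ C_f w(h k) = w(h k ⋆ f) = ⊗ⁿ C_{h k}
w(f) → w(f)`. So the functions `w(h k)`, seen as distributions, converge on tensor powers, and by
polarization on all tensor products. That they then converge to a distribution is a sequential
kernel theorem (`exists_distribution_of_tendsto_tensor`). Its core is a polynomial bound on cut off
plane waves, uniform in `k` (`exists_bound_waveTest`). If it failed, the bad waves could be
superposed into linear maps from bounded sequences to test functions, contradicting
Banach–Steinhaus. Fourier inversion and dominated convergence conclude. -/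

namespace Wilson

open Filter Topology BoundedContinuousFunction

/-! ### Calculus: Taylor expansion and derivatives of superposed translates. -/

section Calculus

variable {V W : Type*} [NormedAddCommGroup V] [NormedSpace ℝ V]
  [NormedAddCommGroup W] [NormedSpace ℝ W]

/-- A directional derivative commutes with the iterated derivatives. -/
lemma fderiv_iteratedFDeriv_apply {f : V → W} (hf : ContDiff ℝ (⊤ : ℕ∞) f) (v : V) (i : ℕ) (y : V) :
    fderiv ℝ (iteratedFDeriv ℝ i f) y v = iteratedFDeriv ℝ i (fun z => fderiv ℝ f z v) y := by
  induction i generalizing y with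
  | zero =>
    ext m
    have hd : DifferentiableAt ℝ f y := hf.differentiable (by simp) y
    have h := (((continuousMultilinearCurryFin0 ℝ V W).symm.toContinuousLinearEquiv :
      W →L[ℝ] V [×0]→L[ℝ] W).hasFDerivAt.comp y hd.hasFDerivAt).fderiv
    rw [iteratedFDeriv_zero_apply]
    exact congr($h v m)
  | succ i ih =>
    have hg : ContDiff ℝ (⊤ : ℕ∞) (iteratedFDeriv ℝ i f) :=
      hf.iteratedFDeriv_right (mod_cast le_top)
    have hg' : ContDiff ℝ (⊤ : ℕ∞) (fderiv ℝ (iteratedFDeriv ℝ i f)) :=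
      hg.fderiv_right (by simp)
    have hsymm : IsSymmSndFDerivAt ℝ (iteratedFDeriv ℝ i f) y :=
      hg.contDiffAt.isSymmSndFDerivAt (by simpa using WithTop.coe_le_coe.2 (le_top : (2 : ℕ∞) ≤ ⊤))
    ext m
    have h := (((continuousMultilinearCurryLeftEquiv ℝ (fun _ : Fin (i + 1) => V)
      W).symm.toContinuousLinearEquiv :
        (V →L[ℝ] V [×i]→L[ℝ] W) →L[ℝ] (V [×(i + 1)]→L[ℝ] W)).hasFDerivAt.comp y
        (hg'.differentiable (by simp) y).hasFDerivAt).fderiv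
    rw [iteratedFDeriv_succ_apply_left]
    refine congr($h v m).trans ?_
    have : iteratedFDeriv ℝ i (fun z => fderiv ℝ f z v) =
        fun z => fderiv ℝ (iteratedFDeriv ℝ i f) z v := by
      funext z; exact (ih z).symm
    rw [this, fderiv_clm_apply (hg'.differentiable (by simp) y) (by fun_prop)]
    simp only [fderiv_fun_const]
    change (fderiv ℝ (fderiv ℝ (iteratedFDeriv ℝ i f)) y v (m 0)) (Fin.tail m) = _
    -- Symmetry of the second derivative of `D^i f` exchanges `v` with the new first argument.
    rw [hsymm.eq v (m 0)]
    simp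

/-- First order Taylor expansion, uniform in the base point. -/
lemma eventually_norm_sub_sub_fderiv_le {f : V → W} (hf : Differentiable ℝ f)
    (hu : UniformContinuous (fderiv ℝ f)) {ε : ℝ} (hε : 0 < ε) :
    ∀ᶠ v in 𝓝 (0 : V), ∀ z, ‖f (z + v) - f z - fderiv ℝ f z v‖ ≤ ε * ‖v‖ := by
  obtain ⟨δ, hδ, h⟩ := Metric.uniformContinuous_iff.1 hu ε hε
  filter_upwards [Metric.ball_mem_nhds (0 : V) hδ] with v hv z
  have hv' : ‖v‖ < δ := by simpa using hv
  have := (convex_segment z (z + v)).norm_image_sub_le_of_norm_fderiv_le' (𝕜 := ℝ) (f := f)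
    (φ := fderiv ℝ f z) (C := ε) (fun x _ => hf x) (fun x hx => ?_)
    (left_mem_segment ℝ _ _) (right_mem_segment ℝ _ _)
  · simpa using this
  · rw [← dist_eq_norm]
    refine (h ?_).le
    rw [segment_eq_image'] at hx
    obtain ⟨t, ht, rfl⟩ := hx
    simp only [add_sub_cancel_left, dist_eq_norm, norm_smul, Real.norm_eq_abs, abs_of_nonneg ht.1]
    nlinarith [ht.2, norm_nonneg v, ht.1]

/-- Iterated derivatives of an integral of translates. -/
lemma iteratedFDeriv_integral_smul_translate [FiniteDimensional ℝ V] [MeasurableSpace V]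
    [BorelSpace V] (ν : Measure V) [ν.IsAddHaarMeasure] {a : V → ℝ}
    (ha : Continuous a) {f : V → W} (hf : ContDiff ℝ (⊤ : ℕ∞) f) (hfc : HasCompactSupport f)
    (i : ℕ) (y : V) :
    iteratedFDeriv ℝ i (fun z => ∫ p, a p • f (z - p) ∂ν) y =
      ∫ p, a p • iteratedFDeriv ℝ i f (y - p) ∂ν := by
  have key (i : ℕ) (y : V) : HasFDerivAt (fun z => ∫ p, a p • iteratedFDeriv ℝ i f (z - p) ∂ν)
      (∫ p, a p • fderiv ℝ (iteratedFDeriv ℝ i f) (y - p) ∂ν) y := by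
    have hg : ContDiff ℝ 1 (iteratedFDeriv ℝ i f) := hf.iteratedFDeriv_right (mod_cast le_top)
    exact (hfc.iteratedFDeriv i).hasFDerivAt_convolution_right (μ := ν)
      (ContinuousLinearMap.lsmul ℝ ℝ) ha.locallyIntegrable hg y
  induction i generalizing y with
  | zero =>
    have h := (continuousMultilinearCurryFin0 ℝ V W).symm.toContinuousLinearEquiv.integral_comp_comm
      (μ := ν) (fun p => a p • f (y - p))
    refine Eq.trans h.symm (integral_congr_ae (.of_forall fun p => ?_))
    exact map_smul _ (a p) _
  | succ i ih =>
    rw [iteratedFDeriv_succ_eq_comp_left, Function.comp_apply, funext ih, (key i y).fderiv]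
    let L : (V →L[ℝ] V [×i]→L[ℝ] W) ≃L[ℝ] (V [×(i + 1)]→L[ℝ] W) :=
      (continuousMultilinearCurryLeftEquiv ℝ (fun _ : Fin (i + 1) => V)
        W).symm.toContinuousLinearEquiv
    -- Currying is an equivalence, so it passes through the integral with no integrability
    -- condition.
    have h := ContinuousLinearEquiv.integral_comp_comm (𝕜 := ℝ) (E := V →L[ℝ] V [×i]→L[ℝ] W)
      (F := V [×(i + 1)]→L[ℝ] W) L (μ := ν) (fun p => a p • fderiv ℝ (iteratedFDeriv ℝ i f) (y - p))
    refine Eq.trans h.symm (integral_congr_ae (.of_forall fun p => ?_))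
    exact map_smul _ (a p) _

end Calculus

end Wilson

/-! ### Local structure of distributions. -/

namespace Wilson

open Filter Topology BoundedContinuousFunction

/-- A linear form dominated by a linear map factors through it continuously. -/
lemma exists_factor_of_norm_le {X Y : Type*} [AddCommGroup X] [Module ℝ X]
    [NormedAddCommGroup Y] [NormedSpace ℝ Y] (ℓ : X →ₗ[ℝ] ℝ) (J : X →ₗ[ℝ] Y) {C : ℝ}
    (h : ∀ x, ‖ℓ x‖ ≤ C * ‖J x‖) : ∃ Λ : Y →L[ℝ] ℝ, ∀ x, ℓ x = Λ (J x) := by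
  -- `g` is a merely algebraic section of `J`. The bound makes `ℓ` vanish on the kernel of `J`, so
  -- `ℓ ∘ g` is bounded on the range, and Hahn–Banach extends it.
  obtain ⟨g, hg⟩ := J.rangeRestrict.exists_rightInverse_of_surjective J.range_rangeRestrict
  have hgJ : ∀ x, ℓ (g (J.rangeRestrict x)) = ℓ x := fun x => by
    have h1 : J.rangeRestrict (g (J.rangeRestrict x)) = J.rangeRestrict x :=
      congr($hg (J.rangeRestrict x))
    have h2 : J (g (J.rangeRestrict x) - x) = 0 := by
      rw [map_sub, sub_eq_zero]
      exact congr(($h1 : Y))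
    have h3 := h (g (J.rangeRestrict x) - x)
    rw [h2, norm_zero, mul_zero, norm_le_zero_iff, map_sub, sub_eq_zero] at h3
    exact h3
  let φ : J.range →L[ℝ] ℝ := (ℓ ∘ₗ g).mkContinuous C (by
    rintro ⟨_, x, rfl⟩
    change ‖ℓ (g (J.rangeRestrict x))‖ ≤ C * ‖J x‖
    rw [hgJ]
    exact h x)
  obtain ⟨Λ, hΛ, -⟩ := exists_extension_norm_eq J.range φ
  refine ⟨Λ, fun x => ?_⟩
  rw [← hgJ]
  exact (hΛ (J.rangeRestrict x)).symm

section LocalStructure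

variable {V : Type*} [NormedAddCommGroup V] [NormedSpace ℝ V]

/-- The `i`-th derivative of a test function as a bounded continuous function. -/
noncomputable def derivBCF (F : Test V) (i : ℕ) : V →ᵇ V [×i]→L[ℝ] ℝ :=
  have hc : Continuous (iteratedFDeriv ℝ i F) :=
    F.contDiff.continuous_iteratedFDeriv (mod_cast le_top)
  .ofNormedAddCommGroup (iteratedFDeriv ℝ i F) hc _
    (hc.bounded_above_of_compact_support (F.hasCompactSupport.iteratedFDeriv i)).choose_spec

@[simp] lemma derivBCF_apply (F : Test V) (i : ℕ) (y : V) :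
    derivBCF F i y = iteratedFDeriv ℝ i F y := rfl

/-- Families of bounded continuous functions, indexed by the orders in `s`, of the type of the
derivatives of a real valued function. -/
def Jet (V : Type*) [NormedAddCommGroup V] [NormedSpace ℝ V] (s : Finset ℕ) : Type _ :=
  (i : s) → V →ᵇ V [×(i : ℕ)]→L[ℝ] ℝ

noncomputable instance (s : Finset ℕ) : NormedAddCommGroup (Jet V s) :=
  inferInstanceAs (NormedAddCommGroup ((i : s) → V →ᵇ V [×(i : ℕ)]→L[ℝ] ℝ))

noncomputable instance (s : Finset ℕ) : NormedSpace ℝ (Jet V s) :=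
  inferInstanceAs (NormedSpace ℝ ((i : s) → V →ᵇ V [×(i : ℕ)]→L[ℝ] ℝ))

instance (s : Finset ℕ) : CompleteSpace (Jet V s) :=
  inferInstanceAs (CompleteSpace ((i : s) → V →ᵇ V [×(i : ℕ)]→L[ℝ] ℝ))

/-- The family of the derivatives of a test function. -/
noncomputable def jet (s : Finset ℕ) (F : Test V) : Jet V s := fun i => derivBCF F i

lemma Jet.norm_le {s : Finset ℕ} {g : Jet V s} {C : ℝ} (hC : 0 ≤ C) (h : ∀ i y, ‖g i y‖ ≤ C) :
    ‖g‖ ≤ C :=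
  (pi_norm_le_iff_of_nonneg hC).2 fun i => (BoundedContinuousFunction.norm_le hC).2 (h i)

/-- On the test functions supported in a compact set, a distribution is a bounded functional of
finitely many derivatives. -/
lemma exists_local_representation (ω : 𝓓'((⊤ : Opens V), ℝ)) (K : Compacts V) :
    ∃ (s : Finset ℕ) (Λ : Jet V s →L[ℝ] ℝ), ∀ f : Test V, tsupport f ⊆ K → ω f = Λ (jet s f) := by
  let ωL : Test V →L[ℝ] ℝ := ω
  have hK : (K : Set V) ⊆ (⊤ : Opens V) := fun _ _ => trivial
  let ωK : 𝓓_{K}(V, ℝ) →L[ℝ] ℝ := ωL ∘L TestFunction.ofSupportedInCLM ℝ hK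
  -- Continuity gives finitely many seminorms, all dominated by the norm of the jet. The resulting
  -- `Λ` lives on a Banach space, where norm estimates and Bochner integrals are available.
  obtain ⟨s, C, -, hC⟩ := Seminorm.bound_of_continuous
    (ContDiffMapSupportedIn.withSeminorms ℝ V ℝ ⊤ K) ((normSeminorm ℝ ℝ).comp ωK.toLinearMap)
    (continuous_norm.comp ωK.continuous)
  let J : 𝓓_{K}(V, ℝ) →ₗ[ℝ] Jet V s :=
    { toFun := fun f i => ContDiffMapSupportedIn.structureMapCLM ℝ ⊤ (i : ℕ) f
      map_add' := fun f g => funext fun i =>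
        (ContDiffMapSupportedIn.structureMapCLM ℝ ⊤ (i : ℕ)).map_add f g
      map_smul' := fun c f => funext fun i =>
        (ContDiffMapSupportedIn.structureMapCLM ℝ ⊤ (i : ℕ)).map_smul c f }
  have hJ : ∀ f, ‖ωK f‖ ≤ C * ‖J f‖ := fun f => by
    refine (hC f).trans ?_
    rw [_root_.smul_apply]
    change (C : ℝ) * _ ≤ C * _
    gcongr
    refine Seminorm.finset_sup_apply_le (norm_nonneg _) fun i hi => ?_
    exact norm_le_pi_norm (G := fun i : s => V →ᵇ V [×(i : ℕ)]→L[ℝ] ℝ) (J f) ⟨i, hi⟩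
  obtain ⟨Λ, hΛ⟩ := exists_factor_of_norm_le ωK.toLinearMap J hJ
  refine ⟨s, Λ, fun f hf => ?_⟩
  let fK : 𝓓_{K}(V, ℝ) := .of_support_subset f.contDiff (subset_closure.trans hf)
  have hfJ : J fK = jet s f := by
    funext i
    ext y : 1
    exact congr($(ContDiffMapSupportedIn.structureMapCLM_top_apply (𝕜 := ℝ) (i := i) fK) y)
  rw [← hfJ, ← hΛ]
  rfl

end LocalStructure

end Wilson

/-! ### Smoothness of `x ↦ ω (τ_x F)`. -/

namespace Wilson

open Filter Topology BoundedContinuousFunction LineDeriv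
open scoped Pointwise

section Translation

variable {V : Type*} [NormedAddCommGroup V] [NormedSpace ℝ V]

/-- The translated test function `y ↦ F (y - x)`. -/
noncomputable def translate (F : Test V) (x : V) : Test V where
  toFun y := F (y - x)
  contDiff' := F.contDiff.comp (contDiff_id.sub contDiff_const)
  hasCompactSupport' := F.hasCompactSupport.comp_homeomorph (Homeomorph.subRight x)
  tsupport_subset' := fun _ _ => trivial

@[simp] lemma translate_apply (F : Test V) (x y : V) : translate F x y = F (y - x) := rfl

@[simp] lemma shiftReflect_apply (F : Test V) (x y : V) : shiftReflect F x y = F (x - y) := rfl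

@[simp] lemma reflect_apply (F : Test V) (y : V) : reflect F y = F (-y) := rfl

lemma shiftReflect_eq_translate (F : Test V) (x : V) :
    shiftReflect F x = translate (reflect F) x := by
  ext y; simp

@[simp] lemma translate_zero (F : Test V) : translate F 0 = F := by
  ext y; simp

lemma translate_add (F G : Test V) (x : V) : translate (F + G) x = translate F x + translate G x :=
  rfl

lemma translate_smul (c : ℝ) (F : Test V) (x : V) : translate (c • F) x = c • translate F x := rfl

lemma lineDerivOp_apply_eq_fderiv (F : Test V) (v y : V) : (∂_{v} F) y = fderiv ℝ F y v := by
  rw [TestFunction.lineDerivOp_eq_lineDerivCLM ℝ, TestFunction.lineDerivCLM_apply_of_le (by simp),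
    (F.contDiff.differentiable (by simp)).differentiableAt.lineDeriv_eq_fderiv]

lemma derivBCF_translate_apply (F : Test V) (i : ℕ) (x y : V) :
    derivBCF (translate F x) i y = iteratedFDeriv ℝ i F (y - x) := by
  rw [derivBCF_apply, ← iteratedFDeriv_comp_sub]
  rfl

lemma uniformContinuous_iteratedFDeriv (F : Test V) (i : ℕ) :
    UniformContinuous (iteratedFDeriv ℝ i F) :=
  (F.contDiff.continuous_iteratedFDeriv (mod_cast le_top)).uniformContinuous_of_tendsto_cocompact
    (F.hasCompactSupport.iteratedFDeriv i).is_zero_at_infty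

lemma continuous_derivBCF_translate (F : Test V) (i : ℕ) :
    Continuous fun x => derivBCF (translate F x) i := by
  refine Metric.continuous_iff.2 fun x ε hε => ?_
  obtain ⟨δ, hδ, h⟩ := Metric.uniformContinuous_iff.1 (uniformContinuous_iteratedFDeriv F i)
    (ε / 2) (half_pos hε)
  refine ⟨δ, hδ, fun x' hx' => lt_of_le_of_lt ?_ (half_lt_self hε)⟩
  refine (BoundedContinuousFunction.dist_le (half_pos hε).le).2 fun y => ?_
  rw [derivBCF_translate_apply, derivBCF_translate_apply]
  refine (h ?_).le
  rwa [dist_sub_left]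

variable [FiniteDimensional ℝ V]

lemma exists_compacts_tsupport_translate (F : Test V) (R : ℝ) :
    ∃ K : Compacts V, ∀ x, ‖x‖ ≤ R → tsupport (translate F x) ⊆ K := by
  have : ProperSpace V := FiniteDimensional.proper_real V
  refine ⟨⟨tsupport F + Metric.closedBall 0 R,
    F.hasCompactSupport.isCompact.add (isCompact_closedBall 0 R)⟩, fun x hx => ?_⟩
  refine closure_minimal (fun y hy => ?_)
    (F.hasCompactSupport.isCompact.add (isCompact_closedBall 0 R)).isClosed
  exact ⟨y - x, subset_closure hy, x, by simpa using hx, by simp⟩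

/-- For `x` near `x₀` all translates are supported in one compact `K`, so the map factors through
the smooth functions supported in `K`, where continuity is tested one derivative at a time. -/
lemma continuous_translate (F : Test V) : Continuous (translate F) := by
  refine continuous_iff_continuousAt.2 fun x₀ => ?_
  obtain ⟨K, hK⟩ := exists_compacts_tsupport_translate F (‖x₀‖ + 1)
  have hB : ∀ x ∈ Metric.ball x₀ 1, ‖x‖ ≤ ‖x₀‖ + 1 := fun x hx => by
    have := norm_le_norm_add_norm_sub' x x₀
    rw [mem_ball_iff_norm] at hx
    linarith
  refine ContinuousOn.continuousAt ?_ (Metric.ball_mem_nhds x₀ one_pos)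
  rw [continuousOn_iff_continuous_domRestrict]
  let φ : Metric.ball x₀ 1 → 𝓓_{K}(V, ℝ) := fun x =>
    .of_support_subset (translate F x).contDiff (subset_closure.trans (hK x (hB x x.2)))
  have hφ : Continuous φ := by
    refine (ContDiffMapSupportedIn.continuous_iff_comp φ).2 fun i => ?_
    convert (continuous_derivBCF_translate F i).comp continuous_subtype_val using 1
    funext x
    ext y : 1
    exact congr($(ContDiffMapSupportedIn.structureMapCLM_top_apply (𝕜 := ℝ) (i := i) (φ x)) y)
  exact (TestFunction.continuous_ofSupportedIn (Ω := ⊤) (fun _ _ => trivial)).comp hφ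

lemma continuous_apply_translate (ω : 𝓓'((⊤ : Opens V), ℝ)) (F : Test V) :
    Continuous fun x => ω (translate F x) :=
  (show Continuous (ω : Test V →L[ℝ] ℝ) from ContinuousLinearMap.continuous _).comp
    (continuous_translate F)

/-- The derivative of `x ↦ ω (τ_x F)`. -/
noncomputable def translateFDeriv (ω : 𝓓'((⊤ : Opens V), ℝ)) (F : Test V) (x : V) : V →L[ℝ] ℝ :=
  LinearMap.toContinuousLinearMap
    { toFun := fun v => -ω (translate (∂_{v} F) x)
      map_add' := fun v w => by
        rw [lineDerivOp_left_add, translate_add, map_add, neg_add]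
      map_smul' := fun c v => by
        rw [lineDerivOp_left_smul, translate_smul, map_smul, RingHom.id_apply, smul_neg] }

@[simp] lemma translateFDeriv_apply (ω : 𝓓'((⊤ : Opens V), ℝ)) (F : Test V) (x v : V) :
    translateFDeriv ω F x v = -ω (translate (∂_{v} F) x) := rfl

/-- The first order remainder is `ω` of a test function `G` supported in a fixed compact set. There
`ω` is `Λ` of finitely many derivatives, and the Taylor expansion of each derivative of `F` is
uniform in the base point. -/
lemma hasFDerivAt_apply_translate (ω : 𝓓'((⊤ : Opens V), ℝ)) (F : Test V) (x : V) :
    HasFDerivAt (fun x => ω (translate F x)) (translateFDeriv ω F x) x := by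
  obtain ⟨K, hK⟩ := exists_compacts_tsupport_translate F (‖x‖ + 1)
  obtain ⟨s, Λ, hΛ⟩ := exists_local_representation ω K
  rw [hasFDerivAt_iff_isLittleO_nhds_zero, Asymptotics.isLittleO_iff]
  intro c hc
  have hε : 0 < c / (‖Λ‖ + 1) := by positivity
  -- The increment is `-v` because `translate F (x + v) y = F (y - x - v)`.
  have hT : ∀ᶠ v in 𝓝 (0 : V), ∀ i : s, ∀ z, ‖iteratedFDeriv ℝ i F (z + -v) - iteratedFDeriv ℝ i F z
      - fderiv ℝ (iteratedFDeriv ℝ i F) z (-v)‖ ≤ c / (‖Λ‖ + 1) * ‖-v‖ := by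
    rw [eventually_all]
    intro i
    have hd : ContDiff ℝ 1 (iteratedFDeriv ℝ i F) :=
      F.contDiff.iteratedFDeriv_right (mod_cast le_top)
    have hu : UniformContinuous (fderiv ℝ (iteratedFDeriv ℝ i F)) :=
      (hd.continuous_fderiv (by simp)).uniformContinuous_of_tendsto_cocompact
        ((F.hasCompactSupport.iteratedFDeriv i).fderiv ℝ).is_zero_at_infty
    have := eventually_norm_sub_sub_fderiv_le (hd.differentiable (by simp)) hu hε
    exact (continuous_neg.tendsto' (0 : V) 0 neg_zero).eventually this
  filter_upwards [hT, Metric.ball_mem_nhds (0 : V) one_pos] with v hv hv1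
  have hv1 : ‖v‖ < 1 := by simpa using hv1
  let G : Test V := translate F (x + v) - translate F x + translate (∂_{v} F) x
  have hGs : tsupport G ⊆ K := by
    refine closure_minimal (fun y hy => ?_) K.isCompact.isClosed
    by_contra hyK
    have h1 : translate F (x + v) y = 0 := image_eq_zero_of_notMem_tsupport fun h =>
      hyK (hK _ ((norm_add_le _ _).trans (by linarith)) h)
    have h2 : y ∉ tsupport (translate F x) := fun h => hyK (hK _ (by linarith) h)
    have h3 : translate (∂_{v} F) x y = 0 := by
      have : fderiv ℝ (translate F x) y = 0 :=
        image_eq_zero_of_notMem_tsupport fun h => h2 (tsupport_fderiv_subset ℝ h)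
      rw [translate_apply, lineDerivOp_apply_eq_fderiv, ← fderiv_comp_sub]
      exact congr($this v)
    refine hy ?_
    change translate F (x + v) y - translate F x y + translate (∂_{v} F) x y = 0
    rw [h1, h3, image_eq_zero_of_notMem_tsupport h2]
    simp
  have hG : ω (translate F (x + v)) - ω (translate F x) - translateFDeriv ω F x v = ω G := by
    simp only [G, map_add, map_sub, translateFDeriv_apply, sub_neg_eq_add]
  rw [hG, hΛ G hGs]
  have hn : ‖jet s G‖ ≤ c / (‖Λ‖ + 1) * ‖v‖ := by
    refine Jet.norm_le (by positivity) fun i y => ?_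
    have hyG : jet s G i y = iteratedFDeriv ℝ i F (y - x + -v) - iteratedFDeriv ℝ i F (y - x)
      - fderiv ℝ (iteratedFDeriv ℝ i F) (y - x) (-v) := by
      have hF : ∀ F : Test V, ContDiff ℝ i F := fun F => F.contDiff.of_le (mod_cast le_top)
      have hv' : ((∂_{v} F : Test V) : V → ℝ) = fun z => fderiv ℝ F z v :=
        funext fun z => lineDerivOp_apply_eq_fderiv F v z
      change iteratedFDeriv ℝ i
        ((translate F (x + v) : V → ℝ) - (translate F x : V → ℝ) +
          (translate (∂_{v} F) x : V → ℝ)) y = _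
      have hd : ContDiff ℝ i ((translate F (x + v) : V → ℝ) - (translate F x : V → ℝ)) :=
        (hF _).sub (hF _)
      rw [iteratedFDeriv_add_apply hd.contDiffAt (hF _).contDiffAt,
        iteratedFDeriv_sub_apply (hF _).contDiffAt (hF _).contDiffAt]
      simp only [← derivBCF_apply, derivBCF_translate_apply]
      rw [map_neg, sub_neg_eq_add, fderiv_iteratedFDeriv_apply F.contDiff, ← hv', ← sub_sub,
        sub_eq_add_neg (y - x) v]
      rfl
    rw [hyG]
    simpa using hv i (y - x)
  calc ‖Λ (jet s G)‖ ≤ ‖Λ‖ * (c / (‖Λ‖ + 1) * ‖v‖) := Λ.le_opNorm_of_le hn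
    _ ≤ c * ‖v‖ := by
      rw [← mul_assoc]
      gcongr
      rw [mul_div_assoc', div_le_iff₀ (by positivity)]
      nlinarith [norm_nonneg Λ]

lemma fderiv_apply_translate (ω : 𝓓'((⊤ : Opens V), ℝ)) (F : Test V) (x v : V) :
    fderiv ℝ (fun x => ω (translate F x)) x v = -ω (translate (∂_{v} F) x) := by
  rw [(hasFDerivAt_apply_translate ω F x).fderiv, translateFDeriv_apply]

/-- Each directional derivative is, up to sign, the same expression with `∂_v F` in place of `F`, so
induction on the order works for all `F` at once. -/
lemma contDiff_apply_translate (ω : 𝓓'((⊤ : Opens V), ℝ)) (F : Test V) :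
    ContDiff ℝ (⊤ : ℕ∞) fun x => ω (translate F x) := by
  refine contDiff_infty.2 fun m => ?_
  induction m generalizing F with
  | zero => exact contDiff_zero.2 (continuous_apply_translate ω F)
  | succ m ih =>
    rw [Nat.cast_add, Nat.cast_one, contDiff_succ_iff_fderiv_apply]
    refine ⟨fun x => (hasFDerivAt_apply_translate ω F x).differentiableAt, by simp, fun v => ?_⟩
    simp_rw [fderiv_apply_translate]
    exact (ih _).neg

end Translation

end Wilson

/-! ### Superpositions of translates, and continuity of regularization in `ω`. -/

namespace Wilson

open Filter Topology BoundedContinuousFunction LineDeriv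

section Regularization

variable {V : Type*} [NormedAddCommGroup V] [NormedSpace ℝ V]

lemma continuous_jet_translate (s : Finset ℕ) (F : Test V) :
    Continuous fun x => jet s (translate F x) :=
  continuous_pi (A := fun i : s => V →ᵇ V [×(i : ℕ)]→L[ℝ] ℝ) fun i =>
    continuous_derivBCF_translate F i

/-- Evaluation of a component of a jet at a point. -/
noncomputable def Jet.eval {s : Finset ℕ} (i : s) (y : V) : Jet V s →L[ℝ] V [×(i : ℕ)]→L[ℝ] ℝ :=
  (BoundedContinuousFunction.evalCLM ℝ y).comp
    (ContinuousLinearMap.proj (R := ℝ) (φ := fun i : s => V →ᵇ V [×(i : ℕ)]→L[ℝ] ℝ) i)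

/-- Homogeneity reduces the operator norm to unit directions. These form a compact set in finite
dimension, which suits the topology on distributions. -/
lemma norm_le_of_unit_ball {W : Type*} [NormedAddCommGroup W] [NormedSpace ℝ W] {m : ℕ}
    (f : V [×m]→L[ℝ] W) {ε : ℝ} (hε : 0 ≤ ε) (h : ∀ v, (∀ i, ‖v i‖ ≤ 1) → ‖f v‖ ≤ ε) : ‖f‖ ≤ ε := by
  refine f.opNorm_le_bound hε fun v => ?_
  by_cases hv : ∃ i, v i = 0
  · obtain ⟨i, hi⟩ := hv
    rw [f.map_coord_zero i hi, norm_zero]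
    positivity
  · push Not at hv
    have h1 : v = fun i => ‖v i‖ • (‖v i‖⁻¹ • v i) := by
      funext i
      rw [smul_smul, mul_inv_cancel₀ (norm_ne_zero_iff.2 (hv i)), one_smul]
    conv_lhs => rw [h1]
    rw [f.map_smul_univ, norm_smul, norm_prod, mul_comm]
    simp only [norm_norm]
    gcongr
    refine h _ fun i => ?_
    rw [norm_smul, norm_inv, norm_norm, inv_mul_cancel₀ (norm_ne_zero_iff.2 (hv i))]

variable [FiniteDimensional ℝ V]

/-- A distribution commutes with integrals of translates of test functions. -/
lemma apply_eq_integral_translate [MeasurableSpace V] [BorelSpace V] (ν : Measure V)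
    [ν.IsAddHaarMeasure] (ω : 𝓓'((⊤ : Opens V), ℝ)) (a F G : Test V)
    (hG : ∀ y, G y = ∫ p, a p * F (y - p) ∂ν) :
    ω G = ∫ p, a p * ω (translate F p) ∂ν := by
  obtain ⟨R, hR⟩ := a.hasCompactSupport.isCompact.isBounded.exists_norm_le
  obtain ⟨K, hK⟩ := exists_compacts_tsupport_translate F R
  obtain ⟨s, Λ, hΛ⟩ := exists_local_representation ω K
  have hGs : tsupport G ⊆ K := by
    refine closure_minimal (fun y hy => ?_) K.isCompact.isClosed
    by_contra hyK
    refine hy ?_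
    rw [hG]
    refine integral_eq_zero_of_ae (.of_forall fun p => ?_)
    by_cases hp : p ∈ tsupport a
    · have : translate F p y = 0 := image_eq_zero_of_notMem_tsupport fun h => hyK (hK _ (hR p hp) h)
      simp only [translate_apply] at this
      simp [this]
    · simp [image_eq_zero_of_notMem_tsupport hp]
  have hint : Integrable (fun p => a p • jet s (translate F p)) ν :=
    (a.continuous.smul (continuous_jet_translate s F)).integrable_of_hasCompactSupport
      a.hasCompactSupport.smul_right
  -- The superposition holds as a Bochner integral of jets, checked by evaluating each component at
  -- each point; `Λ` then passes under the integral.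
  have hjet : jet s G = ∫ p, a p • jet s (translate F p) ∂ν := by
    funext i
    ext y : 1
    have h1 := (Jet.eval i y).integral_comp_comm hint
    have h2 : (Jet.eval i y) (∫ p, a p • jet s (translate F p) ∂ν) =
      (∫ p, a p • jet s (translate F p) ∂ν) i y := rfl
    rw [← h2, ← h1]
    have h3 := iteratedFDeriv_integral_smul_translate ν a.continuous F.contDiff F.hasCompactSupport
      i y
    have h4 : (G : V → ℝ) = fun z => ∫ p, a p • F (z - p) ∂ν := funext hG
    change iteratedFDeriv ℝ i G y = _
    rw [h4, h3]
    refine integral_congr_ae (.of_forall fun p => ?_)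
    change _ = a p • derivBCF (translate F p) i y
    rw [derivBCF_translate_apply]
  rw [hΛ G hGs, hjet, ← Λ.integral_comp_comm hint]
  refine integral_congr_ae (.of_forall fun p => ?_)
  change Λ _ = a p * ω _
  by_cases hp : p ∈ tsupport a
  · rw [hΛ _ (hK _ (hR p hp)), map_smul, smul_eq_mul]
  · simp [image_eq_zero_of_notMem_tsupport hp]

/-- The derivatives of `x ↦ ω (τ_x F)` are given by test functions depending continuously on the
point and on the directions. -/
lemma exists_iteratedFDeriv_apply_translate (m : ℕ) (F : Test V) :
    ∃ Γ : V × (Fin m → V) → Test V, Continuous Γ ∧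
      ∀ (ω : 𝓓'((⊤ : Opens V), ℝ)) (x : V) (v : Fin m → V),
        iteratedFDeriv ℝ m (fun x => ω (translate F x)) x v = ω (Γ (x, v)) := by
  induction m generalizing F with
  | zero =>
    exact ⟨fun p => translate F p.1, (continuous_translate F).comp continuous_fst,
      fun ω x v => by simp⟩
  | succ m ih =>
    let b := Module.finBasis ℝ V
    choose Γ hΓ hΓω using fun j => ih (-(∂_{b j} F))
    -- The last direction enters only through its coordinates, against the fixed test functions
    -- `-∂_{b j} F`, so continuity in the directions reduces to that of scalar coefficients.
    refine ⟨fun p => ∑ j, b.repr (p.2 (Fin.last m)) j • Γ j (p.1, Fin.init p.2), ?_, ?_⟩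
    · refine continuous_finsetSum _ fun j _ => ?_
      have h1 : Continuous fun p : V × (Fin (m + 1) → V) => b.repr (p.2 (Fin.last m)) j :=
        (LinearMap.continuous_of_finiteDimensional (b.coord j)).comp
          ((continuous_apply _).comp continuous_snd)
      have h2 : Continuous fun p : V × (Fin (m + 1) → V) => Γ j (p.1, Fin.init p.2) :=
        (hΓ j).comp (continuous_fst.prodMk (continuous_pi fun i =>
          (continuous_apply (i.castSucc)).comp continuous_snd))
      exact h1.smul h2
    · intro ω x v
      set f := fun x => ω (translate F x) with hf
      have hcd : ContDiff ℝ (⊤ : ℕ∞) (fderiv ℝ f) :=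
        (contDiff_apply_translate ω F).fderiv_right (by simp)
      have key : ∀ u, (iteratedFDeriv ℝ m (fderiv ℝ f) x (Fin.init v)) u =
          iteratedFDeriv ℝ m (fun y => fderiv ℝ f y u) x (Fin.init v) := fun u => by
        have := (ContinuousLinearMap.apply ℝ ℝ u).iteratedFDeriv_comp_left
          (hcd.of_le (m := m) (mod_cast le_top)).contDiffAt (x := x) (i := m) le_rfl
        exact congr($this (Fin.init v)).symm
      rw [iteratedFDeriv_succ_apply_right]
      conv_lhs => rw [← b.sum_repr (v (Fin.last m))]
      rw [map_sum, map_sum]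
      refine Finset.sum_congr rfl fun j _ => ?_
      rw [map_smul, map_smul, key, ← hΓω]
      congr 3
      funext y
      rw [fderiv_apply_translate, ← map_neg]
      rfl

/-- The `m`-th derivative of `x ↦ ω (τ_x F)` as a function of the distribution `ω`. -/
noncomputable def translateDeriv (m : ℕ) (F : Test V) :
    𝓓'((⊤ : Opens V), ℝ) →+ C(V, V [×m]→L[ℝ] ℝ) where
  toFun ω := ⟨iteratedFDeriv ℝ m fun x => ω (translate F x),
    (contDiff_apply_translate ω F).continuous_iteratedFDeriv (mod_cast le_top)⟩
  map_zero' := by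
    ext x : 1
    change iteratedFDeriv ℝ m (fun _ => (0 : ℝ)) x = 0
    simp
  map_add' ω η := by
    ext x : 1
    exact iteratedFDeriv_add_apply
      ((contDiff_apply_translate ω F).of_le (mod_cast le_top)).contDiffAt
      ((contDiff_apply_translate η F).of_le (mod_cast le_top)).contDiffAt

/-- By additivity it suffices to look at zero. The derivatives over a compact set, in unit
directions, are values of `ω` on a compact set of test functions, and the topology on distributions
is uniform convergence on such sets. -/
lemma continuous_translateDeriv (m : ℕ) (F : Test V) : Continuous (translateDeriv m F) := by
  have : ProperSpace V := FiniteDimensional.proper_real V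
  refine continuous_of_continuousAt_zero (translateDeriv m F) ?_
  rw [ContinuousAt, map_zero, ContinuousMap.tendsto_iff_forall_isCompact_tendstoUniformlyOn]
  intro L hL
  rw [Metric.tendstoUniformlyOn_iff]
  intro ε hε
  obtain ⟨Γ, hΓ, hΓω⟩ := exists_iteratedFDeriv_apply_translate m F
  have hS : IsCompact (Γ '' (L ×ˢ Set.univ.pi fun _ : Fin m => Metric.closedBall (0 : V) 1)) :=
    (hL.prod (isCompact_univ_pi fun _ => isCompact_closedBall 0 1)).image hΓ
  filter_upwards [CompactConvergenceCLM.hasBasis_nhds_zero.mem_of_mem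
    (i := (_, Metric.closedBall (0 : ℝ) (ε / 2))) ⟨hS, Metric.closedBall_mem_nhds 0 (half_pos hε)⟩]
    with ω hω x hx
  refine lt_of_le_of_lt ?_ (half_lt_self hε)
  rw [dist_comm, dist_eq_norm]
  refine norm_le_of_unit_ball _ (half_pos hε).le fun v hv => ?_
  have h1 := hω _ ⟨(x, v), ⟨hx, fun i _ => by simpa using hv i⟩, rfl⟩
  rw [← hΓω] at h1
  simpa [translateDeriv] using h1

end Regularization

end Wilson

/-! ### Polarization, convolution of test functions and mollifiers. -/

namespace Wilson

open Filter Topology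

section Polarization

/-- Ryser's formula: the polarization of the product of `n` linear forms. -/
lemma sum_neg_one_pow_mul_prod_sum {R : Type*} [CommRing R] {n : ℕ} (a : Fin n → Fin n → R) :
    ∑ S : Finset (Fin n), (-1 : R) ^ (n - S.card) * ∏ j, ∑ i ∈ S, a i j =
      ∑ σ : Equiv.Perm (Fin n), ∏ j, a (σ j) j := by
  classical
  -- When the products are expanded, the monomial of `g` collects the sets `S` containing the image
  -- of `g`. Their complements run over all subsets of the complement of the image, and this
  -- alternating sum vanishes unless `g` is onto.
  have inner (g : Fin n → Fin n) : ∑ S : Finset (Fin n),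
      (if ∀ j, g j ∈ S then (-1 : R) ^ (n - S.card) else 0) =
        if Function.Bijective g then 1 else 0 := by
    have h1 : ∑ S : Finset (Fin n), (if ∀ j, g j ∈ S then (-1 : R) ^ (n - S.card) else 0) =
        ∑ U ∈ ((Finset.univ.image g)ᶜ).powerset, (-1 : R) ^ U.card := by
      rw [← Finset.sum_filter]
      refine Finset.sum_nbij' (fun S => Sᶜ) (fun U => Uᶜ) ?_ ?_ (by simp) (by simp) ?_
      · intro S hS
        simp only [Finset.mem_filter, Finset.mem_univ, true_and] at hS
        simp only [Finset.mem_powerset, Finset.compl_subset_compl]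
        intro x hx
        obtain ⟨j, -, rfl⟩ := Finset.mem_image.1 hx
        exact hS j
      · intro U hU
        simp only [Finset.mem_powerset] at hU
        simp only [Finset.mem_filter, Finset.mem_univ, true_and, Finset.mem_compl]
        intro j hj
        simpa using hU hj
      · intro S _
        rw [Finset.card_compl, Fintype.card_fin]
    have h2 := congrArg (Int.cast : ℤ → R)
      (Finset.sum_powerset_neg_one_pow_card (x := (Finset.univ.image g)ᶜ))
    push_cast at h2
    rw [h1, h2]
    have h3 : (Finset.univ.image g)ᶜ = ∅ ↔ Function.Bijective g := by
      rw [← Finite.surjective_iff_bijective, Finset.compl_eq_empty_iff, Finset.eq_univ_iff_forall]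
      simp [Function.Surjective]
    simp only [h3]
  calc _ = ∑ S : Finset (Fin n), ∑ g : Fin n → Fin n,
        (∏ j, a (g j) j) * (if ∀ j, g j ∈ S then (-1 : R) ^ (n - S.card) else 0) := by
        refine Finset.sum_congr rfl fun S _ => ?_
        rw [Finset.prod_univ_sum, Finset.mul_sum]
        simp only [mul_ite, mul_zero]
        rw [← Finset.sum_filter]
        refine Finset.sum_congr (by ext; simp) fun g _ => mul_comm _ _
    _ = ∑ g : Fin n → Fin n, if Function.Bijective g then ∏ j, a (g j) j else 0 := by
        rw [Finset.sum_comm]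
        refine Finset.sum_congr rfl fun g _ => ?_
        rw [← Finset.mul_sum, inner]
        simp
    _ = _ := by
        rw [← Finset.sum_filter]
        refine Finset.sum_bij' (fun g hg => Equiv.ofBijective g (Finset.mem_filter.1 hg).2)
          (fun σ _ => σ) (by simp)
          (fun σ _ => Finset.mem_filter.2 ⟨Finset.mem_univ _, σ.bijective⟩) (fun _ _ => rfl)
          (fun σ _ => by ext; rfl) (fun _ _ => rfl)

variable {E : Type*} [NormedAddCommGroup E] [NormedSpace ℝ E] {n : ℕ}

@[simp] lemma tensor_apply (f : Fin n → Test E) (x : Fin n → E) :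
    tensor f x = ∏ i, f i (x i) := rfl

lemma sum_apply {ι : Type*} (s : Finset ι) (f : ι → Test E) (x : E) :
    (∑ i ∈ s, f i) x = ∑ i ∈ s, f i x :=
  map_sum (Distribution.delta x : 𝓓'((⊤ : Opens E), ℝ)) f s

lemma translate_tensor (f : Fin n → Test E) (p : Fin n → E) :
    translate (tensor f) p = tensor fun i => translate (f i) (p i) := by
  ext y; simp

lemma tensor_comp_perm (f : Fin n → Test E) (σ : Equiv.Perm (Fin n)) :
    tensor (fun j => f (σ j)) = permute σ⁻¹ (tensor f) := by
  ext x
  change ∏ j, f (σ j) (x j) = ∏ i, f i (x (σ⁻¹ i))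
  rw [← Equiv.prod_comp σ fun i => f i (x (σ⁻¹ i))]
  simp

lemma sum_smul_tensor_const (f : Fin n → Test E) :
    ∑ S : Finset (Fin n), (-1 : ℝ) ^ (n - S.card) • tensor (fun _ : Fin n => ∑ i ∈ S, f i) =
      ∑ σ : Equiv.Perm (Fin n), permute σ⁻¹ (tensor f) := by
  ext x
  simp only [← tensor_comp_perm, sum_apply, _root_.smul_apply, tensor_apply, smul_eq_mul]
  exact sum_neg_one_pow_mul_prod_sum fun i j => f i (x j)

/-- Polarization of a symmetric distribution on tensor products. -/
lemma SymDist.polarization (ω : SymDist E n) (f : Fin n → Test E) :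
    ω.1 (tensor f) = (1 / (n.factorial : ℝ)) *
      ∑ S : Finset (Fin n), (-1 : ℝ) ^ (n - S.card) * ω.1 (tensor fun _ => ∑ i ∈ S, f i) := by
  have h := congrArg ω.1 (sum_smul_tensor_const f)
  rw [map_sum, map_sum] at h
  simp only [map_smul, smul_eq_mul] at h
  rw [h, Finset.sum_congr rfl fun σ _ => ω.2 σ⁻¹ (tensor f)]
  have : (n.factorial : ℝ) ≠ 0 := by positivity
  simp [Fintype.card_perm]
  field_simp

end Polarization

section ConvTest

variable {V : Type*} [NormedAddCommGroup V] [NormedSpace ℝ V] [FiniteDimensional ℝ V]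
  [MeasurableSpace V] [BorelSpace V] (ν : Measure V) [ν.IsAddHaarMeasure]

/-- The convolution of two test functions as a test function. -/
noncomputable def convTest (a F : Test V) : Test V where
  toFun := a ⋆[ContinuousLinearMap.mul ℝ ℝ, ν] F
  contDiff' := F.hasCompactSupport.contDiff_convolution_right _ a.continuous.locallyIntegrable
    F.contDiff
  hasCompactSupport' := a.hasCompactSupport.convolution _ F.hasCompactSupport
  tsupport_subset' := fun _ _ => trivial

lemma convTest_apply (a F : Test V) (y : V) :
    convTest ν a F y = ∫ p, a p * F (y - p) ∂ν := rfl

lemma convTest_comm (a F : Test V) : convTest ν a F = convTest ν F a := by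
  ext y
  have := convolution_flip (L := ContinuousLinearMap.mul ℝ ℝ) (f := (F : V → ℝ))
    (g := (a : V → ℝ)) (μ := ν)
  rw [ContinuousLinearMap.flip_mul] at this
  exact congr($this y)

/-- Both sides are `ω` of the convolution of `a` and `F`. -/
lemma integral_mul_apply_translate_comm (ω : 𝓓'((⊤ : Opens V), ℝ)) (a F : Test V) :
    ∫ p, a p * ω (translate F p) ∂ν = ∫ p, F p * ω (translate a p) ∂ν := by
  rw [← apply_eq_integral_translate ν ω a F (convTest ν a F) (convTest_apply ν a F),
    ← apply_eq_integral_translate ν ω F a (convTest ν F a) (convTest_apply ν F a),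
    convTest_comm]

end ConvTest

section Mollifier

variable {E : Type*} [NormedAddCommGroup E] [NormedSpace ℝ E]
  [MeasurableSpace E] (μ : Measure E)

/-- A sequence of test functions which approximates the Dirac distribution at the origin. -/
structure IsMollifier (h : ℕ → Test E) : Prop where
  nonneg : ∀ k x, 0 ≤ h k x
  integral_eq_one : ∀ k, ∫ x, h k x ∂μ = 1
  tendsto_support : Tendsto (fun k => Function.support (h k)) atTop (𝓝 0).smallSets

variable {μ} in
lemma IsMollifier.ne_zero {h : ℕ → Test E} (hh : IsMollifier μ h) (k : ℕ) : h k ≠ 0 := by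
  intro h0
  have := hh.integral_eq_one k
  rw [h0] at this
  simp at this

variable [FiniteDimensional ℝ E] [BorelSpace E] [μ.IsAddHaarMeasure]

lemma exists_isMollifier : ∃ h : ℕ → Test E, IsMollifier μ h := by
  let b : ℕ → ContDiffBump (0 : E) := fun k =>
    ⟨1 / (k + 2), 1 / (k + 1), by positivity, by gcongr; norm_num⟩
  refine ⟨fun k => ⟨(b k).normed μ, (b k).contDiff_normed, (b k).hasCompactSupport_normed,
    fun _ _ => trivial⟩, fun k x => (b k).nonneg_normed x, fun k => (b k).integral_normed, ?_⟩
  exact ContDiffBump.tendsto_support_normed_smallSets (φ := b)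
    tendsto_one_div_add_atTop_nhds_zero_nat

variable {μ} {h : ℕ → Test E}

lemma IsMollifier.tendsto_conv (hh : IsMollifier μ h) {φ : E → ℝ} (hφ : Continuous φ) (x : E) :
    Tendsto (fun k => conv μ (h k) φ x) atTop (𝓝 (φ x)) :=
  convolution_tendsto_right (.of_forall hh.nonneg) (.of_forall hh.integral_eq_one)
    hh.tendsto_support (.of_forall fun _ => hφ.aestronglyMeasurable)
    ((hφ.tendsto x).comp tendsto_snd) tendsto_const_nhds

variable {n : ℕ}

lemma IsMollifier.tendsto_tensorConv (hh : IsMollifier μ h) {φ : (Fin n → E) → ℝ}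
    (hφ : Continuous φ) (x : Fin n → E) :
    Tendsto (fun k => tensorConv μ (h k) φ x) atTop (𝓝 (φ x)) := by
  refine convolution_tendsto_right (φ := fun k => (tensor fun _ : Fin n => h k : (Fin n → E) → ℝ))
    (.of_forall fun k y => by
      rw [tensor_apply]
      exact Finset.prod_nonneg fun i _ => hh.nonneg k _)
    (.of_forall fun k => ?_) ?_ (.of_forall fun _ => hφ.aestronglyMeasurable)
    ((hφ.tendsto x).comp tendsto_snd) tendsto_const_nhds
  · simp only [tensor_apply]
    rw [integral_fintype_prod_eq_prod (fun _ => (h k : E → ℝ))]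
    simp [hh.integral_eq_one]
  · rw [tendsto_smallSets_iff]
    intro t ht
    obtain ⟨s, hs, hst⟩ : ∃ s ∈ 𝓝 (0 : E), (Set.univ.pi fun _ : Fin n => s) ⊆ t := by
      rw [nhds_pi, Filter.mem_pi'] at ht
      obtain ⟨I, s, hs, hst⟩ := ht
      exact ⟨⋂ i, s i, Filter.iInter_mem.2 hs, fun y hy => hst fun i _ =>
        Set.mem_iInter.1 (hy i trivial) i⟩
    filter_upwards [tendsto_smallSets_iff.1 hh.tendsto_support s hs] with k hk y hy
    refine hst fun i _ => hk fun h0 => hy ?_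
    exact Finset.prod_eq_zero (Finset.mem_univ i) h0

/-- A distribution is determined by its values on tensor products. -/
lemma eq_zero_of_apply_tensor_eq_zero (μ : Measure E) [μ.IsAddHaarMeasure]
    (ω : 𝓓'((⊤ : Opens (Fin n → E)), ℝ)) (hω : ∀ f : Fin n → Test E, ω (tensor f) = 0) : ω = 0 := by
  obtain ⟨h, hh⟩ := exists_isMollifier μ
  refine DFunLike.ext _ _ fun F => ?_
  -- Mollifying `x ↦ ω (τ_{-x} F)` at the origin converges to `ω F`. Exchanging `F` with the
  -- mollifier turns every term into an integral of `ω` over translated tensor products, which are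
  -- again tensor products.
  have h1 := hh.tendsto_tensorConv (φ := fun x => ω (translate F (-x)))
    ((continuous_apply_translate ω F).comp continuous_neg) 0
  have h2 : ∀ k, tensorConv μ (h k) (fun x => ω (translate F (-x))) 0 = 0 := fun k => by
    rw [tensorConv_apply]
    simp only [zero_sub, neg_neg]
    rw [show (0 : ℝ) = ∫ p, F p * ω (translate (tensor fun _ => h k) p)
        ∂(Measure.pi fun _ : Fin n => μ) by
      simp [translate_tensor, hω]]
    exact integral_mul_apply_translate_comm _ ω (tensor fun _ => h k) F
  simp only [h2, neg_zero, translate_zero] at h1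
  exact tendsto_nhds_unique h1 tendsto_const_nhds

end Mollifier

end Wilson

/-! ### Uniform boundedness on plane waves. -/

namespace Wilson

open Filter Topology BoundedContinuousFunction

section UniformBoundedness

/-- The uniform boundedness principle for multilinear maps. -/
lemma multilinear_banach_steinhaus {X G ι : Type*} [NormedAddCommGroup X] [NormedSpace ℝ X]
    [CompleteSpace X] [NormedAddCommGroup G] [NormedSpace ℝ G] {n : ℕ} (g : ι → X [×n]→L[ℝ] G)
    (h : ∀ x, ∃ C, ∀ i, ‖g i x‖ ≤ C) : ∃ C, ∀ i, ‖g i‖ ≤ C := by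
  induction n with
  | zero =>
    obtain ⟨C, hC⟩ := h 0
    refine ⟨C, fun i => ?_⟩
    rw [← ContinuousMultilinearMap.fin0_apply_norm]
    exact hC i
  | succ n ih =>
    -- With the first variable frozen, the induction hypothesis bounds the curried linear maps
    -- pointwise.
    obtain ⟨C, hC⟩ := banach_steinhaus (g := fun i => (g i).curryLeft) fun x =>
      ih (fun i => (g i).curryLeft x) fun v => h (Fin.cons x v)
    exact ⟨C, fun i => by rw [← ContinuousMultilinearMap.curryLeft_norm]; exact hC i⟩

end UniformBoundedness

section Waves

variable {E : Type*} [NormedAddCommGroup E] [NormedSpace ℝ E]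

/-- The plane wave `y ↦ cos (ℓ y - b)`. -/
noncomputable def wave (ℓ : E →L[ℝ] ℝ) (b : ℝ) (y : E) : ℝ := Real.cos (ℓ y - b)

lemma contDiff_wave (ℓ : E →L[ℝ] ℝ) (b : ℝ) : ContDiff ℝ (⊤ : ℕ∞) (wave ℓ b) :=
  Real.contDiff_cos.comp (ℓ.contDiff.sub contDiff_const)

lemma abs_wave_le_one (ℓ : E →L[ℝ] ℝ) (b : ℝ) (y : E) : |wave ℓ b y| ≤ 1 :=
  Real.abs_cos_le_one _

lemma norm_iteratedFDeriv_wave_le (ℓ : E →L[ℝ] ℝ) (b : ℝ) (i : ℕ) (y : E) :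
    ‖iteratedFDeriv ℝ i (wave ℓ b) y‖ ≤ ‖ℓ‖ ^ i := by
  have hc : ContDiff ℝ (⊤ : ℕ∞) fun t : ℝ => Real.cos (t - b) :=
    Real.contDiff_cos.comp (contDiff_id.sub contDiff_const)
  have h := ℓ.iteratedFDeriv_comp_right hc y (i := i) (mod_cast le_top)
  have h0 : wave ℓ b = (fun t : ℝ => Real.cos (t - b)) ∘ ℓ := rfl
  rw [h0, h]
  refine (ContinuousMultilinearMap.norm_compContinuousLinearMap_le _ _).trans ?_
  rw [Finset.prod_const, Finset.card_univ, Fintype.card_fin,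
    norm_iteratedFDeriv_eq_norm_iteratedDeriv, iteratedDeriv_comp_sub_const]
  exact mul_le_of_le_one_left (by positivity) (Real.abs_iteratedDeriv_cos_le_one i _)

/-- The product of a test function and a smooth function. -/
noncomputable def mulTest (χ : Test E) (φ : E → ℝ) (hφ : ContDiff ℝ (⊤ : ℕ∞) φ) : Test E where
  toFun y := χ y * φ y
  contDiff' := χ.contDiff.mul hφ
  hasCompactSupport' := χ.hasCompactSupport.mul_right
  tsupport_subset' := fun _ _ => trivial

/-- A plane wave cut off by the test function `χ`. -/
noncomputable def waveTest (χ : Test E) (ℓ : E →L[ℝ] ℝ) (b : ℝ) : Test E :=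
  mulTest χ (wave ℓ b) (contDiff_wave ℓ b)

@[simp] lemma waveTest_apply (χ : Test E) (ℓ : E →L[ℝ] ℝ) (b : ℝ) (y : E) :
    waveTest χ ℓ b y = χ y * wave ℓ b y := rfl

/-- The weighted superposition of a sequence of plane waves. -/
noncomputable def waveSeries (ℓ : ℕ → E →L[ℝ] ℝ) (b : ℕ → ℝ) (a : ℕ →ᵇ ℝ) (y : E) : ℝ :=
  ∑' m, a m * ((2 * (1 + ‖ℓ m‖))⁻¹ ^ m * wave (ℓ m) (b m) y)

lemma abs_waveSeries_term_le (ℓ : ℕ → E →L[ℝ] ℝ) (b : ℕ → ℝ) (a : ℕ →ᵇ ℝ) (y : E) (m : ℕ) :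
    ‖a m * ((2 * (1 + ‖ℓ m‖))⁻¹ ^ m * wave (ℓ m) (b m) y)‖ ≤ ‖a‖ * (1 / 2) ^ m := by
  rw [norm_mul, norm_mul, Real.norm_of_nonneg (r := (2 * (1 + ‖ℓ m‖))⁻¹ ^ m) (by positivity)]
  refine mul_le_mul (a.norm_coe_le_norm m) ?_ (by positivity) (norm_nonneg _)
  refine (mul_le_of_le_one_right (by positivity) (abs_wave_le_one _ _ _)).trans ?_
  gcongr
  rw [one_div]
  gcongr
  nlinarith [norm_nonneg (ℓ m)]

lemma summable_waveSeries (ℓ : ℕ → E →L[ℝ] ℝ) (b : ℕ → ℝ) (a : ℕ →ᵇ ℝ) (y : E) :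
    Summable fun m => a m * ((2 * (1 + ‖ℓ m‖))⁻¹ ^ m * wave (ℓ m) (b m) y) :=
  .of_norm_bounded (summable_geometric_two.mul_left ‖a‖) (abs_waveSeries_term_le ℓ b a y)

lemma abs_waveSeries_le (ℓ : ℕ → E →L[ℝ] ℝ) (b : ℕ → ℝ) (a : ℕ →ᵇ ℝ) (y : E) :
    |waveSeries ℓ b a y| ≤ ‖a‖ * 2 := by
  rw [← tsum_geometric_two, ← tsum_mul_left]
  exact tsum_of_norm_bounded (summable_geometric_two.mul_left ‖a‖).hasSum
    (abs_waveSeries_term_le ℓ b a y)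

/-- The `k`-th derivative of the `m`-th wave is at most `‖ℓ m‖ ^ k`. Once `m ≥ k` the weight `(2 *
(1 + ‖ℓ m‖))⁻¹ ^ m` absorbs this and leaves `(1 / 2) ^ m`, for every frequency sequence. -/
lemma contDiff_waveSeries (ℓ : ℕ → E →L[ℝ] ℝ) (b : ℕ → ℝ) (a : ℕ →ᵇ ℝ) :
    ContDiff ℝ (⊤ : ℕ∞) (waveSeries ℓ b a) := by
  refine contDiff_tsum_of_eventually (v := fun _ m => ‖a‖ * (1 / 2) ^ m)
    (fun m => contDiff_const.mul (contDiff_const.mul (contDiff_wave _ _)))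
    (fun k _ => summable_geometric_two.mul_left ‖a‖) fun k _ => ?_
  rw [Nat.cofinite_eq_atTop]
  filter_upwards [eventually_ge_atTop k] with m hm y
  have hw : ContDiffAt ℝ k (wave (ℓ m) (b m)) y :=
    ((contDiff_wave (ℓ m) (b m)).of_le (mod_cast le_top)).contDiffAt
  have h1 : (fun y => a m * ((2 * (1 + ‖ℓ m‖))⁻¹ ^ m * wave (ℓ m) (b m) y)) =
      (a m * (2 * (1 + ‖ℓ m‖))⁻¹ ^ m) • wave (ℓ m) (b m) := by
    funext y; simp [mul_assoc]
  rw [h1, iteratedFDeriv_const_smul_apply hw, norm_smul, norm_mul, mul_assoc]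
  refine mul_le_mul (a.norm_coe_le_norm m) ?_ (by positivity) (norm_nonneg _)
  rw [Real.norm_of_nonneg (by positivity)]
  calc (2 * (1 + ‖ℓ m‖))⁻¹ ^ m * ‖iteratedFDeriv ℝ k (wave (ℓ m) (b m)) y‖
      ≤ (2 * (1 + ‖ℓ m‖))⁻¹ ^ m * (1 + ‖ℓ m‖) ^ m := by
        gcongr
        refine (norm_iteratedFDeriv_wave_le _ _ _ _).trans ?_
        refine (pow_le_pow_left₀ (norm_nonneg _) (by linarith : ‖ℓ m‖ ≤ 1 + ‖ℓ m‖) k).trans ?_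
        exact pow_le_pow_right₀ (by linarith [norm_nonneg (ℓ m)]) hm
    _ = (1 / 2) ^ m := by
        rw [← mul_pow]
        congr 1
        have := norm_nonneg (ℓ m)
        field_simp

/-- The cut off superposition of plane waves depends linearly on the coefficients. -/
noncomputable def waveSeriesTest (χ : Test E) (ℓ : ℕ → E →L[ℝ] ℝ) (b : ℕ → ℝ) :
    (ℕ →ᵇ ℝ) →ₗ[ℝ] Test E where
  toFun a := mulTest χ (waveSeries ℓ b a) (contDiff_waveSeries ℓ b a)
  map_add' a a' := by
    ext y
    change χ y * waveSeries ℓ b (a + a') y = χ y * waveSeries ℓ b a y + χ y * waveSeries ℓ b a' y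
    rw [← mul_add]
    congr 1
    rw [waveSeries, waveSeries, waveSeries,
      ← (summable_waveSeries ℓ b a y).tsum_add (summable_waveSeries ℓ b a' y)]
    refine tsum_congr fun m => ?_
    rw [BoundedContinuousFunction.add_apply, add_mul]
  map_smul' c a := by
    ext y
    change χ y * waveSeries ℓ b (c • a) y = c * (χ y * waveSeries ℓ b a y)
    rw [mul_left_comm]
    congr 1
    rw [waveSeries, waveSeries, ← tsum_mul_left]
    refine tsum_congr fun m => ?_
    exact mul_assoc c (a m) _

/-- This pointwise bound suffices to make the pulled back multilinear forms bounded on bounded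
sequences, since each `T k` is a function; continuity into the space of test functions is not
needed. -/
lemma abs_waveSeriesTest_le (χ : Test E) (ℓ : ℕ → E →L[ℝ] ℝ) (b : ℕ → ℝ) (a : ℕ →ᵇ ℝ) (y : E) :
    |waveSeriesTest χ ℓ b a y| ≤ ‖a‖ * (2 * |χ y|) := by
  change |χ y * waveSeries ℓ b a y| ≤ _
  rw [abs_mul]
  nlinarith [abs_waveSeries_le ℓ b a y, abs_nonneg (χ y)]

/-- The indicator function of `m`. -/
noncomputable def unitSeq (m : ℕ) : ℕ →ᵇ ℝ :=
  BoundedContinuousFunction.ofNormedAddCommGroupDiscrete (Pi.single m 1) 1 fun k => by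
    by_cases h : k = m
    · subst h; simp
    · simp [Pi.single_eq_of_ne h]

lemma norm_unitSeq_le (m : ℕ) : ‖unitSeq m‖ ≤ 1 :=
  (BoundedContinuousFunction.norm_le zero_le_one).2 fun k => by
    change ‖(Pi.single m 1 : ℕ → ℝ) k‖ ≤ 1
    by_cases h : k = m
    · subst h; simp
    · simp [Pi.single_eq_of_ne h]

lemma waveSeriesTest_unitSeq (χ : Test E) (ℓ : ℕ → E →L[ℝ] ℝ) (b : ℕ → ℝ) (m : ℕ) :
    waveSeriesTest χ ℓ b (unitSeq m) = (2 * (1 + ‖ℓ m‖))⁻¹ ^ m • waveTest χ (ℓ m) (b m) := by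
  ext y
  change χ y * waveSeries ℓ b (unitSeq m) y =
    (2 * (1 + ‖ℓ m‖))⁻¹ ^ m * (χ y * wave (ℓ m) (b m) y)
  rw [mul_left_comm, waveSeries, tsum_eq_single m]
  · change χ y * ((Pi.single m 1 : ℕ → ℝ) m * _) = _
    rw [Pi.single_eq_same, one_mul]
  · intro k hk
    change (Pi.single m 1 : ℕ → ℝ) k * _ = _
    rw [Pi.single_eq_of_ne hk, zero_mul]

end Waves

section Bound

variable {E : Type*} [NormedAddCommGroup E] [NormedSpace ℝ E] {n : ℕ}

/-- The tensor product of test functions as a multilinear map. -/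
noncomputable def tensorMultilinear :
    MultilinearMap ℝ (fun _ : Fin n => Test E) (Test (Fin n → E)) where
  toFun := tensor
  map_update_add' f i a b := by
    ext x
    exact ((MultilinearMap.mkPiAlgebra ℝ (Fin n) ℝ).compLinearMap fun j =>
      (Distribution.delta (x j) : Test E →L[ℝ] ℝ).toLinearMap).map_update_add f i a b
  map_update_smul' f i c a := by
    ext x
    exact ((MultilinearMap.mkPiAlgebra ℝ (Fin n) ℝ).compLinearMap fun j =>
      (Distribution.delta (x j) : Test E →L[ℝ] ℝ).toLinearMap).map_update_smul f i c a

variable [FiniteDimensional ℝ E] [MeasurableSpace E] [BorelSpace E]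
  (μ : Measure E) [μ.IsAddHaarMeasure]

/-- The distribution given by a continuous function. -/
noncomputable def funDist (T : (Fin n → E) → ℝ) : 𝓓'((⊤ : Opens (Fin n → E)), ℝ) :=
  TestFunction.integralAgainstBilinCLM (ContinuousLinearMap.mul ℝ ℝ) (Measure.pi fun _ => μ) T

lemma funDist_apply {T : (Fin n → E) → ℝ} (hT : Continuous T) (F : Test (Fin n → E)) :
    funDist μ T F = ∫ y, F y * T y ∂Measure.pi fun _ => μ :=
  TestFunction.integralAgainstBilinCLM_eq_integral (hT.locallyIntegrable.locallyIntegrableOn _)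

/-- Distributions which converge on tensor products are bounded polynomially on plane waves. -/
lemma exists_bound_waveTest {T : ℕ → (Fin n → E) → ℝ} (hT : ∀ k, Continuous (T k))
    (hb : ∀ f : Fin n → Test E, ∃ C, ∀ k, |funDist μ (T k) (tensor f)| ≤ C) (χ : Test E) :
    ∃ (C : ℝ) (m : ℕ), ∀ (k : ℕ) (ℓ : Fin n → E →L[ℝ] ℝ) (b : Fin n → ℝ),
      |funDist μ (T k) (tensor fun i => waveTest χ (ℓ i) (b i))| ≤ C * ∏ i, (1 + ‖ℓ i‖) ^ m := by
  by_contra! hcon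
  -- The factor `2 ^ m` per variable cancels that of the weights, and the extra `m` will exceed the
  -- Banach–Steinhaus constant.
  choose k ℓ b hk using fun m : ℕ => hcon (m * ∏ _i : Fin n, 2 ^ m) m
  let Θ : Fin n → (ℕ →ᵇ ℝ) →ₗ[ℝ] Test E := fun i =>
    waveSeriesTest χ (fun m => ℓ m i) fun m => b m i
  let M : ℕ → MultilinearMap ℝ (fun _ : Fin n => ℕ →ᵇ ℝ) ℝ := fun k =>
    (funDist μ (T k) : Test (Fin n → E) →L[ℝ] ℝ).toLinearMap.compMultilinearMap
      (tensorMultilinear.compLinearMap Θ)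
  have hM : ∀ k a, M k a = ∫ y, (∏ i, Θ i (a i) (y i)) * T k y ∂Measure.pi fun _ => μ :=
    fun k a => funDist_apply μ (hT k) (tensor fun i => Θ i (a i))
  let χ2 : Test (Fin n → E) := tensor fun _ => χ
  have hint : ∀ k, Integrable (fun y => (∏ i : Fin n, (2 * |χ (y i)|)) * |T k y|)
      (Measure.pi fun _ => μ) := fun k => by
    refine Continuous.integrable_of_hasCompactSupport ?_ ?_
    · have := χ.continuous
      have := hT k
      fun_prop
    · refine HasCompactSupport.intro χ2.hasCompactSupport.isCompact fun y hy => ?_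
      have h0 : χ2 y = 0 := image_eq_zero_of_notMem_tsupport hy
      rw [tensor_apply] at h0
      obtain ⟨i, hi, h0⟩ := Finset.prod_eq_zero_iff.1 h0
      rw [Finset.prod_eq_zero hi (by rw [h0]; simp), zero_mul]
  have hbound : ∀ k a, ‖M k a‖ ≤
      (∫ y, (∏ i : Fin n, (2 * |χ (y i)|)) * |T k y| ∂Measure.pi fun _ => μ) * ∏ i, ‖a i‖ := by
    intro k a
    rw [hM, ← integral_mul_const]
    refine norm_integral_le_of_norm_le ((hint k).mul_const _) (.of_forall fun y => ?_)
    rw [norm_mul, norm_prod, mul_right_comm, ← Finset.prod_mul_distrib]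
    refine mul_le_mul_of_nonneg_right ?_ (abs_nonneg _)
    refine Finset.prod_le_prod (fun i _ => norm_nonneg _) fun i _ => ?_
    rw [mul_comm]
    exact abs_waveSeriesTest_le χ _ _ (a i) (y i)
  -- Each `Θ i (a i)` is a test function, so `hb` is precisely pointwise boundedness.
  obtain ⟨C, hC⟩ := multilinear_banach_steinhaus
    (fun k => (M k).mkContinuous _ (hbound k)) fun a => hb fun i => Θ i (a i)
  obtain ⟨m, hm⟩ := exists_nat_gt C
  have h1 : |M (k m) fun _ => unitSeq m| ≤ C := by
    refine (((M (k m)).mkContinuous _ (hbound (k m))).le_opNorm fun _ => unitSeq m).trans ?_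
    refine (mul_le_of_le_one_right (norm_nonneg _) ?_).trans (hC _)
    exact Finset.prod_le_one (fun _ _ => norm_nonneg _) fun _ _ => norm_unitSeq_le m
  -- The unit sequence isolates the `m`-th wave in every variable, together with its weight.
  have h2 : M (k m) (fun _ => unitSeq m) = (∏ i, (2 * (1 + ‖ℓ m i‖))⁻¹ ^ m) *
      funDist μ (T (k m)) (tensor fun i => waveTest χ (ℓ m i) (b m i)) := by
    change funDist μ (T (k m)) (tensorMultilinear fun i => Θ i (unitSeq m)) = _
    simp only [Θ, waveSeriesTest_unitSeq]
    rw [MultilinearMap.map_smul_univ, map_smul, smul_eq_mul]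
    rfl
  have h3 := hk m
  have hP : 0 < ∏ i, (2 * (1 + ‖ℓ m i‖)) ^ m := Finset.prod_pos fun i _ => by positivity
  have h4 : ∏ i, (2 * (1 + ‖ℓ m i‖))⁻¹ ^ m = (∏ i, (2 * (1 + ‖ℓ m i‖)) ^ m)⁻¹ := by
    rw [← Finset.prod_inv_distrib]
    simp only [inv_pow]
  rw [h2, h4, abs_mul, abs_of_pos (inv_pos.2 hP), inv_mul_le_iff₀ hP] at h1
  rw [mul_assoc, ← Finset.prod_mul_distrib] at h3
  simp only [← mul_pow] at h3
  have := h3.trans_le h1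
  rw [mul_comm, mul_lt_mul_iff_right₀ hP] at this
  linarith

end Bound

end Wilson

/-! ### Schwartz functions and Fourier inversion. -/

namespace Wilson
open Filter Topology FourierTransform SchwartzMap
open scoped InnerProductSpace

section Schwartz

variable {D : Type*} [NormedAddCommGroup D] [NormedSpace ℝ D] [FiniteDimensional ℝ D]
  [MeasurableSpace D] [BorelSpace D] (ν : Measure D) [ν.HasTemperateGrowth]

lemma one_add_norm_pow_mul_le {D : Type*} [SeminormedAddCommGroup D] (m : ℕ) (x : D)
    (a : ℝ) (ha : 0 ≤ a) :
    (1 + ‖x‖) ^ m * a ≤ 2 ^ m * (‖x‖ ^ 0 * a + ‖x‖ ^ m * a) := by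
  have h := add_pow_le zero_le_one (norm_nonneg x) m
  rw [← add_mul, ← mul_assoc]
  refine mul_le_mul_of_nonneg_right (h.trans ?_) ha
  rw [one_pow, pow_zero]
  exact mul_le_mul_of_nonneg_right (pow_le_pow_right₀ one_le_two (Nat.sub_le m 1)) (by positivity)

lemma integrable_one_add_norm_pow_mul (g : 𝓢(D, ℂ)) (m : ℕ) :
    Integrable (fun x => (1 + ‖x‖) ^ m * ‖g x‖) ν := by
  refine Integrable.mono' (((g.integrable_pow_mul ν 0).add (g.integrable_pow_mul ν m)).const_mul
    (2 ^ m)) ?_ (.of_forall fun x => ?_)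
  · have := g.continuous
    exact (by fun_prop : Continuous fun x => (1 + ‖x‖) ^ m * ‖g x‖).aestronglyMeasurable
  · rw [Real.norm_of_nonneg (by positivity)]
    exact one_add_norm_pow_mul_le m x _ (norm_nonneg _)

/-- Measurable functions of polynomial growth are tempered distributions. -/
lemma continuous_integral_mul_of_growth {B : D → ℂ} (hB : AEStronglyMeasurable B ν) {C : ℝ}
    {m : ℕ} (hC : ∀ x, ‖B x‖ ≤ C * (1 + ‖x‖) ^ m) :
    Continuous fun g : 𝓢(D, ℂ) => ∫ x, g x * B x ∂ν := by
  have hC0 : 0 ≤ C := by simpa using (norm_nonneg _).trans (hC 0)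
  have hle : ∀ (g : 𝓢(D, ℂ)) x, ‖g x * B x‖ ≤ C * ((1 + ‖x‖) ^ m * ‖g x‖) := fun g x => by
    rw [norm_mul, mul_comm, ← mul_assoc]
    exact mul_le_mul_of_nonneg_right (hC x) (norm_nonneg _)
  have hint : ∀ g : 𝓢(D, ℂ), Integrable (fun x => g x * B x) ν := fun g =>
    Integrable.mono' ((integrable_one_add_norm_pow_mul ν g m).const_mul C)
      (g.continuous.aestronglyMeasurable.mul hB) (.of_forall (hle g))
  let r := ν.integrablePower
  let J := ∫ x, (1 + ‖x‖) ^ (-(r : ℝ)) ∂ν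
  have hJ : 0 ≤ J := integral_nonneg fun x => by positivity
  -- Two integrals, of `‖g‖` and of `‖x‖ ^ m * ‖g‖`, are each bounded by a sum of two of the listed
  -- seminorms, whence the factor `4`; `2 ^ m` comes from expanding `(1 + ‖x‖) ^ m`.
  refine (SchwartzMap.mkCLMtoNormedSpace (𝕜 := ℝ) (σ := RingHom.id ℝ)
    (fun g : 𝓢(D, ℂ) => ∫ x, g x * B x ∂ν) (fun f g => ?_) (fun a f => ?_)
    ⟨{(0, 0), (0 + r, 0), (m + r, 0)}, C * (2 ^ m * (2 ^ r * J * 4)), by positivity,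
      fun g => ?_⟩).continuous
  · simp only [add_apply, add_mul]
    exact integral_add (hint f) (hint g)
  · simp only [smul_apply, smul_mul_assoc]
    exact integral_smul _ _
  · refine (norm_integral_le_of_norm_le
      ((integrable_one_add_norm_pow_mul ν g m).const_mul C) (.of_forall (hle g))).trans ?_
    rw [integral_const_mul, mul_assoc]
    refine mul_le_mul_of_nonneg_left ?_ hC0
    refine (integral_mono (integrable_one_add_norm_pow_mul ν g m)
      (((g.integrable_pow_mul ν 0).add (g.integrable_pow_mul ν m)).const_mul (2 ^ m))
      fun x => one_add_norm_pow_mul_le m x _ (norm_nonneg _)).trans ?_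
    rw [integral_const_mul, mul_assoc]
    refine mul_le_mul_of_nonneg_left ?_ (by positivity)
    simp only [Pi.add_apply]
    rw [integral_add (g.integrable_pow_mul ν 0) (g.integrable_pow_mul ν m)]
    set s : Finset (ℕ × ℕ) := {(0, 0), (0 + r, 0), (m + r, 0)}
    have hs : ∀ p ∈ s, schwartzSeminormFamily ℝ D ℂ p g ≤ s.sup (schwartzSeminormFamily ℝ D ℂ) g :=
      fun p hp => Seminorm.le_def.1 (Finset.le_sup (f := schwartzSeminormFamily ℝ D ℂ) hp) g
    have h0 := hs (0, 0) (by simp [s])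
    have h1 := hs (0 + r, 0) (by simp [s])
    have h2 := hs (m + r, 0) (by simp [s])
    simp only [schwartzSeminormFamily_apply] at h0 h1 h2
    have i0 := integral_pow_mul_iteratedFDeriv_le ℝ ν g 0 0
    have i1 := integral_pow_mul_iteratedFDeriv_le ℝ ν g m 0
    simp only [norm_iteratedFDeriv_zero] at i0 i1
    have e0 : (2 : ℝ) ^ r * J * (SchwartzMap.seminorm ℝ 0 0 g + SchwartzMap.seminorm ℝ (0 + r) 0 g)
        ≤ 2 ^ r * J * (2 * s.sup (schwartzSeminormFamily ℝ D ℂ) g) :=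
      mul_le_mul_of_nonneg_left (by linarith) (by positivity)
    have e1 : (2 : ℝ) ^ r * J * (SchwartzMap.seminorm ℝ 0 0 g + SchwartzMap.seminorm ℝ (m + r) 0 g)
        ≤ 2 ^ r * J * (2 * s.sup (schwartzSeminormFamily ℝ D ℂ) g) :=
      mul_le_mul_of_nonneg_left (by linarith) (by positivity)
    refine (add_le_add (i0.trans e0) (i1.trans e1)).trans (le_of_eq ?_)
    ring

end Schwartz

section Inclusion

variable {V : Type*} [NormedAddCommGroup V] [NormedSpace ℝ V]

/-- The inclusion of the smooth functions supported in `K` into the Schwartz space. -/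
noncomputable def supportedToSchwartz (K : Compacts V) : 𝓓_{K}(V, ℝ) →L[ℝ] 𝓢(V, ℝ) where
  toFun f := f.hasCompactSupport.toSchwartzMap f.contDiff
  map_add' _ _ := rfl
  map_smul' _ _ := rfl
  cont := by
    let Φ : 𝓓_{K}(V, ℝ) →ₗ[ℝ] 𝓢(V, ℝ) :=
      { toFun := fun f => f.hasCompactSupport.toSchwartzMap f.contDiff
        map_add' := fun _ _ => rfl
        map_smul' := fun _ _ => rfl }
    obtain ⟨R, hR0, hR⟩ := K.isCompact.isBounded.exists_pos_norm_le
    refine WithSeminorms.continuous_of_isBounded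
      (ContDiffMapSupportedIn.withSeminorms ℝ V ℝ ⊤ K) (schwartz_withSeminorms ℝ V ℝ) Φ ?_
    refine Seminorm.IsBounded.of_real fun p => ⟨{p.2}, R ^ p.1, ?_⟩
    intro f
    refine SchwartzMap.seminorm_le_bound ℝ p.1 p.2 (Φ f) ?_ fun x => ?_
    · exact mul_nonneg (by positivity) (apply_nonneg _ _)
    · rw [Finset.sup_singleton]
      by_cases hx : x ∈ K
      · change ‖x‖ ^ p.1 * ‖iteratedFDeriv ℝ p.2 f x‖ ≤ R ^ p.1 * _
        gcongr
        · exact hR x hx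
        · exact ContDiffMapSupportedIn.norm_iteratedFDeriv_apply_le_seminorm_top ℝ
      · change ‖x‖ ^ p.1 * ‖iteratedFDeriv ℝ p.2 f x‖ ≤ R ^ p.1 * _
        rw [f.iteratedFDeriv_zero_on_compl hx, Pi.zero_apply, norm_zero, mul_zero]
        exact mul_nonneg (by positivity) (apply_nonneg _ _)

end Inclusion

section Inversion

variable {V : Type*} [NormedAddCommGroup V] [NormedSpace ℝ V] [FiniteDimensional ℝ V]

/-- The linear form `y ↦ 2π⟪ξ, y⟫` in Euclidean coordinates. -/
noncomputable def phase (ξ : EuclideanSpace ℝ (Fin (Module.finrank ℝ V))) : V →L[ℝ] ℝ :=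
  (2 * Real.pi) • (innerSL ℝ ξ ∘L (toEuclidean : V ≃L[ℝ] _).toContinuousLinearMap)

lemma phase_apply (ξ : EuclideanSpace ℝ (Fin (Module.finrank ℝ V))) (y : V) :
    phase ξ y = 2 * Real.pi * ⟪ξ, toEuclidean y⟫_ℝ := rfl

lemma exists_norm_phase_le : ∃ c : ℝ, 1 ≤ c ∧
    ∀ ξ : EuclideanSpace ℝ (Fin (Module.finrank ℝ V)), ‖(phase ξ : V →L[ℝ] ℝ)‖ ≤ c * ‖ξ‖ := by
  let L : V →L[ℝ] EuclideanSpace ℝ (Fin (Module.finrank ℝ V)) :=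
    (toEuclidean : V ≃L[ℝ] _).toContinuousLinearMap
  refine ⟨1 + 2 * Real.pi * ‖L‖, by have := Real.pi_pos; simp; positivity, fun ξ => ?_⟩
  have h := (innerSL ℝ ξ).opNorm_comp_le L
  rw [innerSL_apply_norm] at h
  rw [phase, norm_smul, Real.norm_of_nonneg (by positivity)]
  have := mul_le_mul_of_nonneg_left h (by positivity : 0 ≤ 2 * Real.pi)
  refine this.trans ?_
  nlinarith [norm_nonneg ξ]

variable [MeasurableSpace V] [BorelSpace V]

/-- Fourier inversion against an integrable function. -/
lemma integral_mul_eq_integral_fourier_mul {ν : Measure V} [SFinite ν] {G : V → ℝ}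
    (hG : Integrable G ν) (g : 𝓢(EuclideanSpace ℝ (Fin (Module.finrank ℝ V)), ℂ)) :
    ∫ y, g (toEuclidean y) * G y ∂ν =
      ∫ ξ, 𝓕 g ξ * ∫ y, Complex.exp (phase ξ y * Complex.I) * G y ∂ν := by
  have h1 : ∀ y : V, g (toEuclidean y) * G y =
      ∫ ξ, 𝓕 g ξ * (Complex.exp (phase ξ y * Complex.I) * G y) := fun y => by
    conv_lhs =>
      rw [← fourierInv_fourier_eq (F := 𝓢(EuclideanSpace ℝ (Fin (Module.finrank ℝ V)), ℂ)) g,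
        SchwartzMap.fourierInv_coe, Real.fourierInv_eq']
    rw [← integral_mul_const]
    refine integral_congr_ae (.of_forall fun ξ => ?_)
    simp only [phase_apply, smul_eq_mul]
    ring
  simp_rw [h1, ← integral_const_mul]
  -- Fubini applies because the exponential has modulus one, leaving a product of two integrable
  -- functions.
  rw [integral_integral_swap]
  have h2 := ((hG.ofReal (𝕜 := ℂ)).mul_prod (𝓕 g).integrable (μ := ν) (ν := volume))
  have h3 : Continuous fun z : V × EuclideanSpace ℝ (Fin (Module.finrank ℝ V)) =>
      Complex.exp (phase z.2 z.1 * Complex.I) := by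
    simp only [phase_apply]
    fun_prop
  refine (h2.bdd_mul h3.aestronglyMeasurable (c := 1) (.of_forall fun z => ?_)).congr
    (.of_forall fun z => ?_)
  · rw [Complex.norm_exp_ofReal_mul_I]
  · simp only [Function.uncurry]
    simp
    ring

end Inversion

end Wilson

/-! ### Convergence on tensor products implies convergence to a distribution. -/

namespace Wilson
open Filter Topology FourierTransform SchwartzMap

section Kernel

variable {E : Type*} [NormedAddCommGroup E] [NormedSpace ℝ E] {n : ℕ}

lemma norm_comp_single_le (ℓ : (Fin n → E) →L[ℝ] ℝ) (i : Fin n) :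
    ‖ℓ ∘L ContinuousLinearMap.single ℝ (fun _ => E) i‖ ≤ ‖ℓ‖ :=
  ContinuousLinearMap.opNorm_le_bound _ (norm_nonneg _) fun v => by
    refine (ℓ.le_opNorm _).trans_eq ?_
    simp [Pi.norm_single]

lemma apply_eq_sum_comp_single (ℓ : (Fin n → E) →L[ℝ] ℝ) (y : Fin n → E) :
    ℓ y = ∑ i, (ℓ ∘L ContinuousLinearMap.single ℝ (fun _ => E) i) (y i) := by
  conv_lhs => rw [← Finset.univ_sum_single y, map_sum]
  rfl

/-- A plane wave on a product is a combination of products of real plane waves. -/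
lemma exp_eq_sum_prod_wave (ℓ : (Fin n → E) →L[ℝ] ℝ) (y : Fin n → E) :
    Complex.exp (ℓ y * Complex.I) = ∑ S : Finset (Fin n), Complex.I ^ (n - S.card) *
      ((∏ i, wave (ℓ ∘L ContinuousLinearMap.single ℝ (fun _ => E) i)
        (if i ∈ S then 0 else Real.pi / 2) (y i) : ℝ) : ℂ) := by
  rw [apply_eq_sum_comp_single, Complex.ofReal_sum, Finset.sum_mul, Complex.exp_sum]
  simp only [Complex.exp_mul_I]
  -- In the expansion of `∏ (cos + sin * I)`, `S` is the set of factors contributing the cosine; the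
  -- sine is a wave with offset `π / 2`.
  rw [Finset.prod_add, Finset.powerset_univ]
  refine Finset.sum_congr rfl fun S _ => ?_
  rw [Complex.ofReal_prod, ← Finset.prod_mul_prod_compl S, Finset.prod_mul_distrib,
    Finset.prod_const, ← Finset.compl_eq_univ_sdiff, Finset.card_compl, Fintype.card_fin]
  rw [mul_comm (∏ i ∈ Sᶜ, _) (Complex.I ^ _), mul_left_comm]
  congr 2
  · refine Finset.prod_congr rfl fun i hi => ?_
    simp [wave, hi]
  · refine Finset.prod_congr rfl fun i hi => ?_
    rw [Finset.mem_compl] at hi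
    simp [wave, hi, Complex.cos_sub_pi_div_two]

variable [FiniteDimensional ℝ E]

/-- Every compact set of a product is contained in the set where some `χ ⊗ ⋯ ⊗ χ` is one. -/
lemma exists_tensor_eq_one (K : Compacts (Fin n → E)) :
    ∃ χ : Test E, ∀ y ∈ K, tensor (fun _ : Fin n => χ) y = 1 := by
  obtain ⟨R, hR0, hR⟩ := K.isCompact.isBounded.exists_pos_norm_le
  let b : ContDiffBump (0 : E) := ⟨R, R + 1, hR0, by linarith⟩
  refine ⟨⟨b, b.contDiff, b.hasCompactSupport, fun _ _ => trivial⟩, fun y hy => ?_⟩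
  rw [tensor_apply]
  refine Finset.prod_eq_one fun i _ => b.one_of_mem_closedBall ?_
  rw [mem_closedBall_zero_iff]
  exact (norm_le_pi_norm y i).trans (hR y hy)

variable [MeasurableSpace E] [BorelSpace E]
  (μ : Measure E) [μ.IsAddHaarMeasure]

lemma integrable_test_mul (F : Test (Fin n → E)) {T : (Fin n → E) → ℝ} (hT : Continuous T) :
    Integrable (fun y => F y * T y) (Measure.pi fun _ => μ) :=
  (F.continuous.mul hT).integrable_of_hasCompactSupport F.hasCompactSupport.mul_right

/-- Bounds and limits known on tensor products thus become bounds and limits of a Fourier integral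
of the cut off `T`. -/
lemma integral_exp_mul_eq_sum_funDist (χ : Test E) {T : (Fin n → E) → ℝ} (hT : Continuous T)
    (ℓ : (Fin n → E) →L[ℝ] ℝ) :
    ∫ y, Complex.exp (ℓ y * Complex.I) * ((tensor (fun _ : Fin n => χ) y * T y : ℝ) : ℂ)
        ∂Measure.pi (fun _ => μ) =
      ∑ S : Finset (Fin n), Complex.I ^ (n - S.card) * (funDist μ T (tensor fun i =>
        waveTest χ (ℓ ∘L ContinuousLinearMap.single ℝ (fun _ => E) i)
          (if i ∈ S then 0 else Real.pi / 2)) : ℂ) := by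
  simp_rw [exp_eq_sum_prod_wave, Finset.sum_mul, mul_assoc, ← Complex.ofReal_mul]
  have h : ∀ (S : Finset (Fin n)) (y : Fin n → E),
      (∏ i, wave (ℓ ∘L ContinuousLinearMap.single ℝ (fun _ => E) i)
        (if i ∈ S then 0 else Real.pi / 2) (y i)) * (tensor (fun _ : Fin n => χ) y * T y) =
      tensor (fun i => waveTest χ (ℓ ∘L ContinuousLinearMap.single ℝ (fun _ => E) i)
          (if i ∈ S then 0 else Real.pi / 2)) y * T y := fun S y => by
    simp only [tensor_apply, waveTest_apply, Finset.prod_mul_distrib]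
    ring
  simp_rw [h]
  rw [integral_finsetSum]
  · refine Finset.sum_congr rfl fun S _ => ?_
    rw [integral_const_mul, integral_complex_ofReal, funDist_apply μ hT]
  · exact fun S _ => ((integrable_test_mul μ _ hT).ofReal).const_mul _

/-- Continuous functions which converge as functionals on tensor products of test functions
converge to a distribution. -/
theorem exists_distribution_of_tendsto_tensor {T : ℕ → (Fin n → E) → ℝ}
    (hT : ∀ k, Continuous (T k))
    (hconv : ∀ f : Fin n → Test E, ∃ l, Tendsto (fun k => funDist μ (T k) (tensor f)) atTop (𝓝 l)) :
    ∃ ω : 𝓓'((⊤ : Opens (Fin n → E)), ℝ), ∀ F : Test (Fin n → E),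
      Tendsto (fun k => funDist μ (T k) F) atTop (𝓝 (ω F)) := by
  have hb : ∀ f : Fin n → Test E, ∃ C, ∀ k, |funDist μ (T k) (tensor f)| ≤ C := fun f => by
    obtain ⟨l, hl⟩ := hconv f
    obtain ⟨C, hC⟩ := (Metric.isBounded_range_of_tendsto _ hl).exists_norm_le
    exact ⟨C, fun k => hC _ ⟨k, rfl⟩⟩
  have hlocal : ∀ K : Compacts (Fin n → E), ∃ A : 𝓓_{K}(Fin n → E, ℝ) → ℝ, Continuous A ∧
      ∀ f, Tendsto (fun k => funDist μ (T k)
        (TestFunction.ofSupportedIn (Set.subset_univ _) f)) atTop (𝓝 (A f)) := by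
    intro K
    obtain ⟨χ, hχ⟩ := exists_tensor_eq_one K
    obtain ⟨C, m, hC⟩ := exists_bound_waveTest μ hT hb χ
    obtain ⟨c, hc1, hc⟩ := exists_norm_phase_le (V := Fin n → E)
    let X := EuclideanSpace ℝ (Fin (Module.finrank ℝ (Fin n → E)))
    let B : ℕ → X → ℂ := fun k ξ => ∫ y, Complex.exp ((phase ξ : (Fin n → E) →L[ℝ] ℝ) y * Complex.I)
      * ((tensor (fun _ : Fin n => χ) y * T k y : ℝ) : ℂ) ∂Measure.pi fun _ => μ
    have hC0 : 0 ≤ C := by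
      have := (abs_nonneg _).trans (hC 0 0 0)
      simpa using this
    -- There are `2 ^ n` sets `S`, and each of the `n` variables contributes `(c * (1 + ‖ξ‖)) ^ m`.
    -- The bound does not depend on `k`.
    have hBle : ∀ k ξ, ‖B k ξ‖ ≤ 2 ^ n * C * c ^ (m * n) * (1 + ‖ξ‖) ^ (m * n) := by
      intro k ξ
      simp only [B]
      rw [integral_exp_mul_eq_sum_funDist μ χ (hT k)]
      have hp : ∀ i, 1 + ‖(phase ξ : (Fin n → E) →L[ℝ] ℝ) ∘L
          ContinuousLinearMap.single ℝ (fun _ => E) i‖ ≤ c * (1 + ‖ξ‖) := fun i => by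
        have := (norm_comp_single_le (phase ξ : (Fin n → E) →L[ℝ] ℝ) i).trans (hc ξ)
        linarith
      have h1 : ∀ S ∈ (Finset.univ : Finset (Finset (Fin n))),
          ‖Complex.I ^ (n - S.card) * (funDist μ (T k) (tensor fun i =>
            waveTest χ ((phase ξ : (Fin n → E) →L[ℝ] ℝ) ∘L
              ContinuousLinearMap.single ℝ (fun _ => E) i)
              (if i ∈ S then 0 else Real.pi / 2)) : ℂ)‖ ≤ C * (c * (1 + ‖ξ‖)) ^ (m * n) := by
        intro S _
        rw [norm_mul, norm_pow, Complex.norm_I, one_pow, one_mul, Complex.norm_real]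
        refine (hC k _ _).trans (mul_le_mul_of_nonneg_left ?_ hC0)
        refine (Finset.prod_le_prod (fun i _ => by positivity)
          fun i _ => pow_le_pow_left₀ (by positivity) (hp i) m).trans_eq ?_
        rw [Finset.prod_const, Finset.card_univ, Fintype.card_fin, ← pow_mul]
      refine (norm_sum_le_of_le _ h1).trans_eq ?_
      rw [Finset.sum_const, Finset.card_univ, Fintype.card_finset, Fintype.card_fin, nsmul_eq_mul,
        mul_pow]
      push_cast
      ring
    have hBlim : ∀ ξ, ∃ l, Tendsto (fun k => B k ξ) atTop (𝓝 l) := by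
      intro ξ
      simp only [B]
      simp_rw [fun k => integral_exp_mul_eq_sum_funDist μ χ (hT k)]
      choose l hl using fun S : Finset (Fin n) => hconv fun i =>
        waveTest χ ((phase ξ : (Fin n → E) →L[ℝ] ℝ) ∘L
          ContinuousLinearMap.single ℝ (fun _ => E) i) (if i ∈ S then 0 else Real.pi / 2)
      exact ⟨_, tendsto_finsetSum _ fun S _ =>
        ((Complex.continuous_ofReal.tendsto _).comp (hl S)).const_mul _⟩
    choose B' hB' using hBlim
    have hBmeas : ∀ k, StronglyMeasurable (B k) := fun k => by
      refine Continuous.stronglyMeasurable ?_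
      have hint := (integrable_test_mul μ (tensor fun _ => χ) (hT k)).norm
      refine continuous_of_dominated (fun ξ => ?_) (fun ξ => .of_forall fun y => ?_) hint
        (.of_forall fun y => ?_)
      · have := (tensor fun _ : Fin n => χ).continuous
        have := hT k
        exact Continuous.aestronglyMeasurable (by fun_prop)
      · rw [norm_mul, Complex.norm_exp_ofReal_mul_I, one_mul, Complex.norm_real]
      · simp only [phase_apply]
        fun_prop
    have hB'meas : AEStronglyMeasurable B' (volume : Measure X) :=
      aestronglyMeasurable_of_tendsto_ae atTop (fun k => (hBmeas k).aestronglyMeasurable)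
        (.of_forall hB')
    have hB'le : ∀ ξ, ‖B' ξ‖ ≤ 2 ^ n * C * c ^ (m * n) * (1 + ‖ξ‖) ^ (m * n) := fun ξ =>
      le_of_tendsto (hB' ξ).norm (.of_forall fun k => hBle k ξ)
    let ι : 𝓓_{K}(Fin n → E, ℝ) →L[ℝ] 𝓢(X, ℂ) :=
      (postcompCLM (𝕜 := ℝ) Complex.ofRealCLM ∘L
        compCLMOfContinuousLinearEquiv ℝ (toEuclidean : (Fin n → E) ≃L[ℝ] X).symm) ∘L
        supportedToSchwartz K
    have hι : ∀ f y, ι f (toEuclidean y) = (f y : ℂ) := fun f y => by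
      change ((f ((toEuclidean : (Fin n → E) ≃L[ℝ] X).symm (toEuclidean y)) : ℝ) : ℂ) = _
      rw [ContinuousLinearEquiv.symm_apply_apply]
    -- The cutoff equals one on `K`, so it is invisible to functions supported there.
    have hkey : ∀ k f, (funDist μ (T k) (TestFunction.ofSupportedIn (Set.subset_univ _) f) : ℂ) =
        ∫ ξ, 𝓕 (ι f) ξ * B k ξ := fun k f => by
      simp only [B]
      rw [← integral_mul_eq_integral_fourier_mul (integrable_test_mul μ (tensor fun _ => χ) (hT k)),
        funDist_apply μ (hT k), ← integral_complex_ofReal]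
      refine integral_congr_ae (.of_forall fun y => ?_)
      simp only [hι]
      change ((f y * T k y : ℝ) : ℂ) = _
      by_cases hy : y ∈ K
      · simp [hχ y hy]
      · have : f y = 0 := f.zero_on_compl hy
        simp [this]
    refine ⟨fun f => (∫ ξ, 𝓕 (ι f) ξ * B' ξ).re, ?_, fun f => ?_⟩
    · exact Complex.continuous_re.comp
        ((continuous_integral_mul_of_growth volume hB'meas hB'le).comp
          ((FourierTransform.fourierCLM ℝ 𝓢(X, ℂ)).continuous.comp ι.continuous))
    · have h1 : Tendsto (fun k => ∫ ξ, 𝓕 (ι f) ξ * B k ξ) atTop (𝓝 (∫ ξ, 𝓕 (ι f) ξ * B' ξ)) := by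
        refine tendsto_integral_of_dominated_convergence _ (fun k =>
          (𝓕 (ι f)).continuous.aestronglyMeasurable.mul (hBmeas k).aestronglyMeasurable)
          ((integrable_one_add_norm_pow_mul volume (𝓕 (ι f)) (m * n)).const_mul
            (2 ^ n * C * c ^ (m * n))) (fun k => .of_forall fun ξ => ?_)
          (.of_forall fun ξ => (hB' ξ).const_mul _)
        rw [norm_mul, mul_comm, ← mul_assoc]
        exact mul_le_mul_of_nonneg_right (hBle k ξ) (norm_nonneg _)
      have h2 := (Complex.continuous_re.tendsto _).comp h1
      refine h2.congr fun k => ?_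
      rw [Function.comp_apply, ← hkey, Complex.ofReal_re]
  choose A hAc hA using hlocal
  have hlim : ∀ F : Test (Fin n → E), ∃ l, Tendsto (fun k => funDist μ (T k) F) atTop (𝓝 l) := by
    intro F
    exact ⟨_, hA ⟨tsupport F, F.hasCompactSupport⟩ (.of_support_subset F.contDiff subset_closure)⟩
  choose l hl using hlim
  -- Linearity passes to the limit, and continuity need only be checked on each `K`, where the limit
  -- is the continuous `A`.
  refine ⟨TestFunction.mkCLM ℝ l (fun F G => ?_) (fun a F => ?_) fun K hK => ?_, hl⟩
  · refine tendsto_nhds_unique (hl (F + G)) (((hl F).add (hl G)).congr fun k => ?_)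
    rw [map_add]
  · refine tendsto_nhds_unique (hl (a • F)) (((hl F).const_smul a).congr fun k => ?_)
    rw [map_smul]
  · refine (hAc K).congr fun f => ?_
    exact tendsto_nhds_unique (hA K f) (hl _)

end Kernel

end Wilson

/-! ### Flows: injectivity, surjectivity and the inverse. -/

namespace Wilson
open Filter Topology

section Flows

variable {E : Type*} [NormedAddCommGroup E] [NormedSpace ℝ E] {n : ℕ}

lemma shiftReflect_tensor_zero (f : Test E) :
    shiftReflect (tensor fun _ : Fin n => f) 0 = tensor fun _ => reflect f := by
  ext y; simp

@[simp] lemma reflect_reflect (f : Test E) : reflect (reflect f) = f := by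
  ext y; simp

lemma reflect_sum {ι : Type*} (s : Finset ι) (f : ι → Test E) :
    reflect (∑ i ∈ s, f i) = ∑ i ∈ s, reflect (f i) := by
  ext y; simp

lemma reflect_ne_zero {f : Test E} (hf : f ≠ 0) : reflect f ≠ 0 := fun h => hf <| by
  rw [← reflect_reflect f, h]
  ext y; simp

lemma tensor_const_zero (hn : n ≠ 0) : tensor (fun _ : Fin n => (0 : Test E)) = 0 := by
  ext x
  simp [hn]

lemma tensorConvDist_eq_apply_translate (f : Test E) (ω : 𝓓'((⊤ : Opens (Fin n → E)), ℝ)) :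
    tensorConvDist f ω = fun x => ω (translate (reflect (tensor fun _ => f)) x) := by
  funext x
  rw [← shiftReflect_eq_translate]
  rfl

lemma tensorConvDist_zero (f : Test E) (ω : 𝓓'((⊤ : Opens (Fin n → E)), ℝ)) :
    tensorConvDist f ω 0 = ω (tensor fun _ => reflect f) := by
  rw [tensorConvDist, shiftReflect_tensor_zero]

lemma permute_shiftReflect_tensor (f : Test E) (σ : Equiv.Perm (Fin n)) (x : Fin n → E) :
    permute σ (shiftReflect (tensor fun _ => f) fun i => x (σ i)) =
      shiftReflect (tensor fun _ => f) x := by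
  ext y
  change ∏ i, f (x (σ i) - y (σ i)) = ∏ i, f (x i - y i)
  exact Equiv.prod_comp σ fun i => f (x i - y i)

lemma tensor_eq_integral_of_eq_conv [MeasurableSpace E] (μ : Measure E) [SigmaFinite μ]
    {f g h : Test E} (hf : (f : E → ℝ) = conv μ h g)
    (z : Fin n → E) :
    tensor (fun _ => f) z =
      ∫ p, tensor (fun _ => h) p * tensor (fun _ => g) (z - p) ∂Measure.pi fun _ => μ := by
  simp only [tensor_apply, ← Finset.prod_mul_distrib, Pi.sub_apply]
  rw [integral_fintype_prod_eq_prod (fun i p => h p * g (z i - p))]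
  refine Finset.prod_congr rfl fun i _ => ?_
  rw [hf]
  rfl

variable [FiniteDimensional ℝ E]

/-- A distribution convolved with `f ⊗ ⋯ ⊗ f`, as a symmetric smooth function. -/
noncomputable def SymDist.smoothing (ω : SymDist E n) (f : Test E) : SymSmooth E n :=
  Subtype.mk (p := (· ∈ symSmoothSubmodule E n)) (tensorConvDist f ω.1)
    ⟨by
      rw [tensorConvDist_eq_apply_translate]
      exact contDiff_apply_translate _ _,
    fun σ x => by
      rw [tensorConvDist, tensorConvDist, ← ω.2 σ, permute_shiftReflect_tensor]⟩

lemma SymDist.continuous_smoothing (f : Test E) :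
    Continuous fun ω : SymDist E n => SymDist.smoothing ω f := by
  refine continuous_iInf_rng.2 fun m => continuous_induced_rng.2 ?_
  refine ((continuous_translateDeriv m (reflect (tensor fun _ => f))).comp
    continuous_subtype_val).congr fun ω => ?_
  ext1 x
  change iteratedFDeriv ℝ m (fun x => ω.1 (translate (reflect (tensor fun _ => f)) x)) x =
    iteratedFDeriv ℝ m (tensorConvDist f ω.1) x
  rw [tensorConvDist_eq_apply_translate]

variable [MeasurableSpace E] [BorelSpace E] (μ : Measure E) [μ.IsAddHaarMeasure]

/-- Flows are indexed by nonzero `f`. For `n = 0` the tensor product is empty and independent of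
`f`, so any nonzero test function can replace `0`; for `n ≥ 1` the tensor power of `0` is `0`. -/
lemma tensor_const_induction {P : Test (Fin n → E) → Prop} (h0 : P 0)
    (h : ∀ f : Test E, f ≠ 0 → P (tensor fun _ => f)) (f : Test E) : P (tensor fun _ => f) := by
  by_cases hf : f = 0
  · rcases n with _ | n
    · obtain ⟨g, hg⟩ := exists_isMollifier (Measure.addHaar : Measure E)
      convert h (g 0) (hg.ne_zero 0) using 2
    · rw [hf, tensor_const_zero n.succ_ne_zero]
      exact h0
  · exact h f hf

lemma SymDist.ext_tensor {ω η : SymDist E n}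
    (h : ∀ f : Fin n → Test E, ω.1 (tensor f) = η.1 (tensor f)) : ω = η := by
  refine Subtype.ext (sub_eq_zero.1
    (eq_zero_of_apply_tensor_eq_zero (Measure.addHaar : Measure E) _ fun f => ?_))
  change ω.1 (tensor f) - η.1 (tensor f) = 0
  rw [h, sub_self]

/-- The reflected shift of the tensor power of `f` is a superposition of translates of that of `g`,
weighted by the reflected tensor power of `h`; `ω` commutes with it. -/
lemma tensorConvDist_eq_tensorConv {f g h : Test E} (hf : (f : E → ℝ) = conv μ h g)
    (ω : 𝓓'((⊤ : Opens (Fin n → E)), ℝ)) :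
    tensorConvDist f ω = tensorConv μ h (tensorConvDist g ω) := by
  funext x
  rw [tensorConv_apply, ← integral_neg_eq_self]
  have key := apply_eq_integral_translate (Measure.pi fun _ => μ) ω
    (reflect (tensor fun _ => h)) (shiftReflect (tensor fun _ => g) x)
    (shiftReflect (tensor fun _ => f) x) fun y => by
      rw [shiftReflect_apply, tensor_eq_integral_of_eq_conv μ hf, ← integral_neg_eq_self]
      refine integral_congr_ae (.of_forall fun p => ?_)
      simp only [reflect_apply, shiftReflect_apply]
      congr 2
      abel
  rw [tensorConvDist, key]
  refine integral_congr_ae (.of_forall fun p => ?_)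
  change tensor (fun _ => h) (-p) * _ = tensor (fun _ => h) (-p) * _
  rw [tensorConvDist]
  congr 2
  ext y
  simp only [translate_apply, shiftReflect_apply]
  congr 1
  abel

/-- The symmetric Wilsonian flow `f ↦ ⊗ⁿ C_f ω` of a symmetric distribution. -/
noncomputable def SymDist.flow : SymDist E n →L[ℝ] SymFlow E μ n where
  toFun ω := ⟨fun f => SymDist.smoothing ω f.1, fun _ _ _ hf =>
    tensorConvDist_eq_tensorConv μ hf ω.1⟩
  map_add' _ _ := rfl
  map_smul' _ _ := rfl
  cont := by
    refine Continuous.subtype_mk (continuous_pi fun f => ?_) _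
    exact SymDist.continuous_smoothing f.1

lemma SymDist.flow_injective :
    Function.Injective (SymDist.flow μ : SymDist E n → SymFlow E μ n) := by
  intro ω η h
  refine SymDist.ext_tensor fun f => ?_
  have hconst : ∀ f : Test E, ω.1 (tensor fun _ => f) = η.1 (tensor fun _ => f) := by
    refine tensor_const_induction (P := fun F => ω.1 F = η.1 F) (by rw [map_zero, map_zero])
      fun f hf => ?_
    have h1 : SymDist.smoothing ω (reflect f) = SymDist.smoothing η (reflect f) :=
      congrFun (congrArg Subtype.val h) ⟨reflect f, reflect_ne_zero hf⟩
    have h2 : tensorConvDist (reflect f) ω.1 0 = tensorConvDist (reflect f) η.1 0 :=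
      congrFun (congrArg Subtype.val h1) 0
    rwa [tensorConvDist_zero, tensorConvDist_zero, reflect_reflect] at h2
  rw [SymDist.polarization ω, SymDist.polarization η]
  simp only [hconst]

lemma funDist_mem_symDist (φ : SymSmooth E n) : funDist μ φ ∈ SymDist E n := by
  intro σ F
  have hφ : Continuous (φ : (Fin n → E) → ℝ) := φ.2.1.continuous
  rw [funDist_apply μ hφ, funDist_apply μ hφ]
  have h := (measurePreserving_piCongrLeft (fun _ : Fin n => μ) σ.symm).integral_comp'
    fun y => F y * φ y
  rw [← h]
  refine integral_congr_ae (.of_forall fun y => ?_)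
  have h2 : MeasurableEquiv.piCongrLeft (fun _ : Fin n => E) σ.symm y = fun i => y (σ i) := by
    funext i
    obtain ⟨j, rfl⟩ := σ.symm.surjective i
    rw [MeasurableEquiv.coe_piCongrLeft, Equiv.piCongrLeft_apply_apply, Equiv.apply_symm_apply]
  change F (fun i => y (σ i)) * φ y = F _ * φ _
  rw [h2, φ.2.2]

lemma funDist_shiftReflect_tensor (f : Test E) {T : (Fin n → E) → ℝ} (hT : Continuous T)
    (x : Fin n → E) :
    funDist μ T (shiftReflect (tensor fun _ => f) x) = tensorConv μ f T x := by
  rw [funDist_apply μ hT, tensorConv_apply,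
    ← integral_sub_left_eq_self (fun y => (∏ i, f (y i)) * T (x - y)) _ x]
  simp

/-- Since `h k ⋆ f = f ⋆ h k`, the flow equation can be read in two ways: convolving `w(h k)` by `f`
equals mollifying `w(f)` by `h k`. -/
lemma SymFlow.tendsto_funDist {h : ℕ → Test E} (hh : IsMollifier μ h) (w : SymFlow E μ n)
    (f : {f : Test E // f ≠ 0}) (x : Fin n → E) :
    Tendsto (fun k => funDist μ (w.1 ⟨h k, hh.ne_zero k⟩) (shiftReflect (tensor fun _ => f.1) x))
      atTop (𝓝 (w.1 f x)) := by
  -- The flow equation requires `h k ⋆ f ≠ 0`, which holds eventually because its value at a point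
  -- where `f` does not vanish tends to that of `f`.
  have hne : ∀ᶠ k in atTop, convTest μ (h k) f.1 ≠ 0 := by
    obtain ⟨y, hy⟩ : ∃ y, f.1 y ≠ 0 := by
      by_contra! hcon
      exact f.2 (by ext y; simp [hcon])
    filter_upwards [(hh.tendsto_conv f.1.continuous y).eventually_ne hy] with k hk h0
    exact hk (DFunLike.congr_fun h0 y)
  refine (hh.tendsto_tensorConv (w.1 f).2.1.continuous x).congr' ?_
  filter_upwards [hne] with k hk
  rw [funDist_shiftReflect_tensor μ f.1 (w.1 _).2.1.continuous]
  have h1 := w.2 ⟨_, hk⟩ f ⟨h k, hh.ne_zero k⟩ rfl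
  have h2 := w.2 ⟨_, hk⟩ ⟨h k, hh.ne_zero k⟩ f (congrArg DFunLike.coe (convTest_comm μ (h k) f.1))
  exact congrFun (h1.symm.trans h2) x

lemma SymDist.flow_surjective :
    Function.Surjective (SymDist.flow μ : SymDist E n → SymFlow E μ n) := by
  intro w
  obtain ⟨h, hh⟩ := exists_isMollifier μ
  let T : ℕ → SymSmooth E n := fun k => w.1 ⟨h k, hh.ne_zero k⟩
  have hconst : ∀ f : Test E,
      ∃ l, Tendsto (fun k => funDist μ (T k) (tensor fun _ : Fin n => f)) atTop (𝓝 l) := by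
    refine tensor_const_induction
      (P := fun F => ∃ l, Tendsto (fun k => funDist μ (T k) F) atTop (𝓝 l))
      ⟨0, by simp only [map_zero]; exact tendsto_const_nhds⟩ fun f hf => ?_
    have := SymFlow.tendsto_funDist μ hh w ⟨reflect f, reflect_ne_zero hf⟩ 0
    simp only [shiftReflect_tensor_zero, reflect_reflect] at this
    exact ⟨_, this⟩
  choose l hl using hconst
  obtain ⟨ω, hω⟩ := exists_distribution_of_tendsto_tensor μ
    (T := fun k => T k) (fun k => (T k).2.1.continuous) fun f => by
      refine ⟨_, ((tendsto_finsetSum Finset.univ fun S _ =>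
        (hl (∑ i ∈ S, f i)).const_mul ((-1 : ℝ) ^ (n - S.card))).const_mul
          (1 / (n.factorial : ℝ))).congr fun k => ?_⟩
      -- Each `T k` is symmetric, so its values on all tensor products are fixed combinations of
      -- those on tensor powers.
      exact (SymDist.polarization ⟨_, funDist_mem_symDist μ (T k)⟩ f).symm
  refine ⟨⟨ω, fun σ F => tendsto_nhds_unique (hω (permute σ F)) ((hω F).congr fun k =>
    (funDist_mem_symDist μ (T k) σ F).symm)⟩, ?_⟩
  refine Subtype.ext (funext fun f => Subtype.ext (funext fun x => ?_))
  exact tendsto_nhds_unique (hω _) (SymFlow.tendsto_funDist μ hh w f x)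

/-- Evaluation at a point. -/
noncomputable def SymSmooth.eval (x : Fin n → E) : SymSmooth E n →ₗ[ℝ] ℝ where
  toFun φ := φ x
  map_add' _ _ := rfl
  map_smul' _ _ := rfl

/-- Evaluation at the origin undoes the reflection, leaving the polarization formula. The convention
`Π_0 w = 0` agrees with `ω` on the tensor power of `0` because `n ≠ 0`. -/
lemma SymDist.tilde_flow (hn : n ≠ 0) (ω : SymDist E n) (f : Fin n → Test E) :
    tilde (SymDist.flow μ ω) f = ω.1 (tensor f) := by
  have hproj : ∀ g : Test E, SymSmooth.eval 0 (proj (reflect g) (SymDist.flow μ ω)) =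
      ω.1 (tensor fun _ => g) := by
    intro g
    by_cases hg : g = 0
    · have hg' : reflect g = 0 := by subst hg; ext y; simp
      rw [proj, dif_pos hg', hg, tensor_const_zero hn, map_zero, map_zero]
    · rw [proj, dif_neg (reflect_ne_zero hg)]
      change tensorConvDist (reflect g) ω.1 0 = _
      rw [tensorConvDist_zero, reflect_reflect]
  change SymSmooth.eval 0 (polarProj (fun i => reflect (f i)) (SymDist.flow μ ω)) = _
  rw [polarProj, map_smul, map_sum, SymDist.polarization ω, smul_eq_mul]
  simp only [map_smul, ← reflect_sum, hproj, smul_eq_mul]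

end Flows

end Wilson

theorem mainTheorem1 {E : Type*} [NormedAddCommGroup E] [NormedSpace ℝ E] [FiniteDimensional ℝ E]
    [MeasurableSpace E] [BorelSpace E] (μ : Measure E) [μ.IsAddHaarMeasure] (n : ℕ) :
    ∃ j : Wilson.SymDist E n →L[ℝ] Wilson.SymFlow E μ n,
      (∀ (ω : Wilson.SymDist E n) (f : {f : Wilson.Test E // f ≠ 0}) (x : Fin n → E),
        (j ω).1 f x = Wilson.tensorConvDist f.1 ω.1 x) ∧
      Function.Bijective j ∧
      (1 ≤ n → ∃ k : Wilson.SymFlow E μ n →ₗ[ℝ] Wilson.SymDist E n,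
        (∀ (w : Wilson.SymFlow E μ n) (ω : Wilson.SymDist E n),
          k w = ω ↔ ∀ f : Fin n → Wilson.Test E, ω.1 (Wilson.tensor f) = Wilson.tilde w f) ∧
        Function.LeftInverse k j ∧ Function.RightInverse k j) := by
  have hbij : Function.Bijective (Wilson.SymDist.flow μ : Wilson.SymDist E n → _) :=
    ⟨Wilson.SymDist.flow_injective μ, Wilson.SymDist.flow_surjective μ⟩
  refine ⟨Wilson.SymDist.flow μ, fun _ _ _ => rfl, hbij, fun hn => ?_⟩
  have hn : n ≠ 0 := by omega
  let e : Wilson.SymDist E n ≃ₗ[ℝ] Wilson.SymFlow E μ n :=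
    LinearEquiv.ofBijective (Wilson.SymDist.flow μ).toLinearMap hbij
  refine ⟨e.symm.toLinearMap, fun w ω => ?_, e.symm_apply_apply, e.apply_symm_apply⟩
  -- Every flow comes from some `η`, so the characterization of `k` becomes the statement that
  -- tensor products determine a symmetric distribution.
  obtain ⟨η, rfl⟩ := e.surjective w
  change e.symm (e η) = ω ↔ ∀ f, ω.1 (Wilson.tensor f) = Wilson.tilde (Wilson.SymDist.flow μ η) f
  rw [e.symm_apply_apply]
  simp only [Wilson.SymDist.tilde_flow μ hn]
  exact ⟨fun h f => by rw [h], fun h => Wilson.SymDist.ext_tensor fun f => (h f).symm⟩
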